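/- Let $\beta\in[0,1]$ be irrational and let $\lambda_1,\lambda_2>0$ be real numbers. Put $$a(n)=(\lambda_1-\lambda_2)\bigl(\lfloor (n+1)\beta\rfloor-\lfloor n\beta\rfloor\bigr)+\lambda_2,\qquad n\in\mathbb Z,$$ and let $H$ be the bounded self-adjoint off-diagonal Sturmian Jacobi operator on $\ell^2(\mathbb Z)$ given by $$(H\psi)(n)=a(n)\,\psi(n+1)+a(n-1)\,\psi(n-1).$$ Write $\beta=[a_1,a_2,\dots]=\cfrac{1}{a_1+\cfrac{1}{a_2+\cdots}}$ for the continued fraction expansion of $\beta$, and let $q_n$ be the denominators of its convergents: $q_{-1}=0$, $q_0=1$, $q_{k+1}=a_{k+1}q_k+q_{k-1}$ for $k\ge 0$. For $E\in\mathbb R$ let $$T_n(E)=\frac1{a(n)}\begin{pmatrix}E&-1\\ a(n)^2&0\end{pmatrix},\qquad M_n(E)=T_{q_n}(E)\,T_{q_n-1}(E)\cdots T_1(E),\qquad x_n(E)=\operatorname{Tr}M_n(E)\quad(n\ge 0),$$ and let $B_\infty=\{E\in\mathbb R:\ \text{the sequence }(x_n(E))_{n\ge0}\text{ is bounded}\}$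 be the pseudo-spectrum. Then $$\sigma(H)=B_\infty .$$ -/

import Mathlib

noncomputable section

namespace SturmianJacobi

/-! ## Jacobi operators on the two-sided square-summable sequences -/

/-- The Hilbert space of square-summable complex sequences indexed by the integers. -/
abbrev EllTwo : Type := lp (fun _ : ℤ => ℂ) 2

theorem memlp_weighted_shift {c : ℤ → ℝ} {C : ℝ} (hc : ∀ n, |c n| ≤ C) (k : ℤ) (ψ : EllTwo) :
    Memℓp (fun n : ℤ => (c n : ℂ) * ψ (n + k)) 2 := by
  have h2 : (0 : ℝ) < (2 : ENNReal).toReal := by norm_num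
  have hs : Summable fun n : ℤ => ‖ψ (n + k)‖ ^ (2 : ENNReal).toReal :=
    ((lp.memℓp ψ).summable h2).comp_injective (add_left_injective k)
  have hC : 0 ≤ C := (abs_nonneg _).trans (hc 0)
  refine memℓp_gen (Summable.of_nonneg_of_le (fun n => by positivity) (fun n => ?_)
    (hs.mul_left (C ^ (2 : ENNReal).toReal)))
  rw [← Real.mul_rpow hC (norm_nonneg _), norm_mul, Complex.norm_real, Real.norm_eq_abs]
  exact Real.rpow_le_rpow (by positivity)
    (mul_le_mul_of_nonneg_right (hc n) (norm_nonneg _)) h2.le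

/-- The bounded operator `(W ψ)(n) = c(n) ψ(n + k)`, for a bounded real sequence `c`. -/
def weightedShift (c : ℤ → ℝ) (hc : ∃ C, ∀ n, |c n| ≤ C) (k : ℤ) : EllTwo →L[ℂ] EllTwo :=
  LinearMap.mkContinuousOfExistsBound
    { toFun := fun ψ => ⟨fun n => (c n : ℂ) * ψ (n + k), memlp_weighted_shift hc.choose_spec k ψ⟩
      map_add' := fun φ ψ => by
        apply lp.ext
        funext n
        exact mul_add (c n : ℂ) (φ (n + k)) (ψ (n + k))
      map_smul' := fun z ψ => by
        apply lp.ext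
        funext n
        exact mul_left_comm (c n : ℂ) z (ψ (n + k)) }
    (by
      obtain ⟨C, hC⟩ := hc
      have h2 : (0 : ℝ) < (2 : ENNReal).toReal := by norm_num
      have hC0 : 0 ≤ C := (abs_nonneg _).trans (hC 0)
      refine ⟨C, fun ψ => lp.norm_le_of_tsum_le h2 (by positivity) ?_⟩
      have hs : Summable fun n : ℤ => ‖ψ (n + k)‖ ^ (2 : ENNReal).toReal :=
        ((lp.memℓp ψ).summable h2).comp_injective (add_left_injective k)
      have hle : ∀ n : ℤ, ‖(c n : ℂ) * ψ (n + k)‖ ^ (2 : ENNReal).toReal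
          ≤ C ^ (2 : ENNReal).toReal * ‖ψ (n + k)‖ ^ (2 : ENNReal).toReal := fun n => by
        rw [← Real.mul_rpow hC0 (norm_nonneg _), norm_mul, Complex.norm_real, Real.norm_eq_abs]
        exact Real.rpow_le_rpow (by positivity)
          (mul_le_mul_of_nonneg_right (hC n) (norm_nonneg _)) h2.le
      have hsum : ∑' n : ℤ, ‖ψ (n + k)‖ ^ (2 : ENNReal).toReal = ‖ψ‖ ^ (2 : ENNReal).toReal := by
        rw [lp.norm_rpow_eq_tsum h2 ψ]
        exact (Equiv.addRight k).tsum_eq fun n : ℤ => ‖ψ n‖ ^ (2 : ENNReal).toReal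
      calc ∑' n : ℤ, ‖(c n : ℂ) * ψ (n + k)‖ ^ (2 : ENNReal).toReal
          ≤ ∑' n : ℤ, C ^ (2 : ENNReal).toReal * ‖ψ (n + k)‖ ^ (2 : ENNReal).toReal :=
            Summable.tsum_le_tsum hle
              ((memlp_weighted_shift hC k ψ).summable h2) (hs.mul_left _)
        _ = (C * ‖ψ‖) ^ (2 : ENNReal).toReal := by
            rw [tsum_mul_left, hsum, Real.mul_rpow hC0 (norm_nonneg _)])

theorem weightedShift_apply (c : ℤ → ℝ) (hc : ∃ C, ∀ n, |c n| ≤ C) (k : ℤ) (ψ : EllTwo) (n : ℤ) :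
    weightedShift c hc k ψ n = (c n : ℂ) * ψ (n + k) := rfl

/-- The Jacobi operator with bounded off-diagonal sequence `a` and bounded diagonal sequence `b`;
its action is spelled out in `jacobiOperator_apply`. -/
def jacobiOperator (a b : ℤ → ℝ) (ha : ∃ C, ∀ n, |a n| ≤ C) (hb : ∃ C, ∀ n, |b n| ≤ C) :
    EllTwo →L[ℂ] EllTwo :=
  weightedShift a ha 1
    + weightedShift (fun n => a (n - 1)) (ha.imp fun _ h n => h (n - 1)) (-1)
    + weightedShift b hb 0

theorem jacobiOperator_apply (a b : ℤ → ℝ) (ha : ∃ C, ∀ n, |a n| ≤ C)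
    (hb : ∃ C, ∀ n, |b n| ≤ C) (ψ : EllTwo) (n : ℤ) :
    jacobiOperator a b ha hb ψ n
      = (a n : ℂ) * ψ (n + 1) + (a (n - 1) : ℂ) * ψ (n - 1) + (b n : ℂ) * ψ n := by
  have h : jacobiOperator a b ha hb ψ n
      = (a n : ℂ) * ψ (n + 1) + (a (n - 1) : ℂ) * ψ (n + -1) + (b n : ℂ) * ψ (n + 0) := rfl
  rw [h, add_zero, ← sub_eq_add_neg]

/-! ## The off-diagonal Sturmian operator -/

/-- The Sturmian sequence `⌊(n+1)β⌋ - ⌊nβ⌋` of slope `β`. -/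
def sturmian (β : ℝ) (n : ℤ) : ℤ := ⌊((n : ℝ) + 1) * β⌋ - ⌊(n : ℝ) * β⌋

/-- The hopping sequence `a(n) = (λ₁ - λ₂)(⌊(n+1)β⌋ - ⌊nβ⌋) + λ₂`. -/
def hopping (β lam₁ lam₂ : ℝ) (n : ℤ) : ℝ := (lam₁ - lam₂) * (sturmian β n : ℝ) + lam₂

theorem abs_sturmian_le (β : ℝ) (n : ℤ) : |(sturmian β n : ℝ)| ≤ |β| + 1 := by
  have h1 := Int.floor_le (((n : ℝ) + 1) * β)
  have h2 := Int.lt_floor_add_one (((n : ℝ) + 1) * β)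
  have h3 := Int.floor_le ((n : ℝ) * β)
  have h4 := Int.lt_floor_add_one ((n : ℝ) * β)
  have h5 := le_abs_self β
  have h6 := neg_abs_le β
  have h7 : ((n : ℝ) + 1) * β = (n : ℝ) * β + β := by ring
  rw [h7] at h1 h2
  rw [sturmian, h7, Int.cast_sub, abs_le]
  constructor <;> linarith

theorem hopping_bounded (β lam₁ lam₂ : ℝ) : ∃ C, ∀ n, |hopping β lam₁ lam₂ n| ≤ C := by
  refine ⟨|lam₁ - lam₂| * (|β| + 1) + |lam₂|, fun n => ?_⟩
  refine (abs_add_le _ _).trans (add_le_add ?_ le_rfl)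
  rw [abs_mul]
  exact mul_le_mul_of_nonneg_left (abs_sturmian_le β n) (abs_nonneg _)

/-- The off-diagonal Sturmian operator: the Jacobi operator with off-diagonal sequence
`hopping β lam₁ lam₂` and zero diagonal. -/
def offDiagonalOperator (β lam₁ lam₂ : ℝ) : EllTwo →L[ℂ] EllTwo :=
  jacobiOperator (hopping β lam₁ lam₂) (fun _ => 0) (hopping_bounded β lam₁ lam₂)
    ⟨0, fun _ => by simp⟩

/-! ## Continued fraction denominators, transfer matrices and the pseudo-spectrum -/

/-- The partial quotients of `β = 1 / (a₁ + 1 / (a₂ + ⋯))` for an irrational `β` in `(0, 1)`: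
`partialQuotient β k` is `a_{k+1}`, obtained by iterating the Gauss map `x ↦ fract (1 / x)`. -/
def partialQuotient (β : ℝ) (k : ℕ) : ℕ := ⌊((fun x : ℝ => Int.fract x⁻¹)^[k] β)⁻¹⌋₊

/-- The denominators of the convergents of `β`:
`q₀ = 1`, `q₁ = a₁` and `q_{k+2} = a_{k+2} q_{k+1} + q_k`. -/
def convergentDen (β : ℝ) : ℕ → ℕ
  | 0 => 1
  | 1 => partialQuotient β 0
  | k + 2 => partialQuotient β (k + 1) * convergentDen β (k + 1) + convergentDen β k

/-- The one-step transfer matrix of the off-diagonal model, for a hopping value `a`. -/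
def stepMatrix (a E : ℝ) : Matrix (Fin 2) (Fin 2) ℝ := (1 / a) • !![E, -1; a ^ 2, 0]

/-- The product `F_n(E) = T_n(E) ⋯ T_1(E)` of one-step transfer matrices. -/
def transferProduct (a : ℤ → ℝ) (E : ℝ) : ℕ → Matrix (Fin 2) (Fin 2) ℝ
  | 0 => 1
  | n + 1 => stepMatrix (a ((n : ℤ) + 1)) E * transferProduct a E n

/-- The transfer matrix `M_n(E) = F_{q_n}(E)`. -/
def transferMatrix (β lam₁ lam₂ E : ℝ) (n : ℕ) : Matrix (Fin 2) (Fin 2) ℝ :=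
  transferProduct (hopping β lam₁ lam₂) E (convergentDen β n)

/-- The trace `x_n(E) = Tr M_n(E)`. -/
def traceSeq (β lam₁ lam₂ E : ℝ) (n : ℕ) : ℝ := (transferMatrix β lam₁ lam₂ E n).trace

/-- The pseudo-spectrum: the real energies at which the sequence `x_n(E)` is bounded. -/
def pseudoSpectrum (β lam₁ lam₂ : ℝ) : Set ℝ :=
  {E : ℝ | ∃ C : ℝ, ∀ n : ℕ, |traceSeq β lam₁ lam₂ E n| ≤ C}

end SturmianJacobi

end

noncomputable section

namespace SturmianJacobi

/-! ## Convergents and the repetition structure of the Sturmian sequence -/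

/-- The iterates of the Gauss map. -/
def gaussIterate (β : ℝ) (k : ℕ) : ℝ := (fun x : ℝ => Int.fract x⁻¹)^[k] β

theorem gaussIterate_succ (β : ℝ) (k : ℕ) :
    gaussIterate β (k + 1) = Int.fract (gaussIterate β k)⁻¹ :=
  Function.iterate_succ_apply' _ _ _

/-- The numerators of the convergents of `β`. -/
def convergentNum (β : ℝ) : ℕ → ℕ
  | 0 => 0
  | 1 => 1
  | k + 2 => partialQuotient β (k + 1) * convergentNum β (k + 1) + convergentNum β k

/-- The signed approximation error `q_n β - p_n`. -/
def convergentError (β : ℝ) (n : ℕ) : ℝ := convergentDen β n * β - convergentNum β n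

theorem convergentDen_add_two (β : ℝ) (k : ℕ) : convergentDen β (k + 2)
    = partialQuotient β (k + 1) * convergentDen β (k + 1) + convergentDen β k := rfl

theorem convergentNum_add_two (β : ℝ) (k : ℕ) : convergentNum β (k + 2)
    = partialQuotient β (k + 1) * convergentNum β (k + 1) + convergentNum β k := rfl

section Irrational

variable {β : ℝ}

theorem gaussIterate_irrational (hirr : Irrational β) (k : ℕ) : Irrational (gaussIterate β k) := by
  induction k with
  | zero => exact hirr
  | succ k ih =>
    rw [gaussIterate_succ, Int.fract]
    exact (irrational_inv_iff.mpr ih).sub_intCast _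

theorem gaussIterate_mem (hβ : β ∈ Set.Icc (0 : ℝ) 1) (hirr : Irrational β) (k : ℕ) :
    0 < gaussIterate β k ∧ gaussIterate β k < 1 := by
  have hne := (gaussIterate_irrational hirr k).ne_zero
  have hne1 := (gaussIterate_irrational hirr k).ne_one
  cases k with
  | zero => exact ⟨lt_of_le_of_ne hβ.1 hne.symm, lt_of_le_of_ne hβ.2 hne1⟩
  | succ k =>
    rw [gaussIterate_succ] at *
    exact ⟨lt_of_le_of_ne (Int.fract_nonneg _) hne.symm, Int.fract_lt_one _⟩

theorem partialQuotient_eq (hβ : β ∈ Set.Icc (0 : ℝ) 1) (hirr : Irrational β) (k : ℕ) :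
    (partialQuotient β k : ℝ) = (gaussIterate β k)⁻¹ - gaussIterate β (k + 1) := by
  have h := gaussIterate_mem hβ hirr k
  have h0 : 0 ≤ (gaussIterate β k)⁻¹ := (inv_pos.mpr h.1).le
  rw [gaussIterate_succ, Int.self_sub_fract]
  change ((⌊(gaussIterate β k)⁻¹⌋₊ : ℕ) : ℝ) = _
  exact natCast_floor_eq_intCast_floor h0

theorem partialQuotient_pos (hβ : β ∈ Set.Icc (0 : ℝ) 1) (hirr : Irrational β) (k : ℕ) :
    1 ≤ partialQuotient β k := by
  have h := gaussIterate_mem hβ hirr k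
  exact Nat.le_floor (by exact_mod_cast (one_lt_inv₀ h.1).mpr h.2 |>.le)

theorem convergentError_succ (hβ : β ∈ Set.Icc (0 : ℝ) 1) (hirr : Irrational β) (n : ℕ) :
    convergentError β (n + 1) = - gaussIterate β (n + 1) * convergentError β n := by
  have hpos := fun k => (gaussIterate_mem hβ hirr k).1
  induction n with
  | zero =>
    have h0 : gaussIterate β 0 = β := rfl
    have := hpos 0
    have hq := partialQuotient_eq hβ hirr 0
    rw [h0] at this hq
    simp only [convergentError, convergentDen, convergentNum, hq]
    push_cast
    field_simp
    ring
  | succ n ih =>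
    have hq := partialQuotient_eq hβ hirr (n + 1)
    have h1 : convergentError β (n + 2)
        = partialQuotient β (n + 1) * convergentError β (n + 1) + convergentError β n := by
      simp only [convergentError, convergentDen_add_two, convergentNum_add_two]
      push_cast
      ring
    have := hpos (n + 1)
    rw [h1, hq, ih]
    field_simp
    ring

theorem convergentError_sign (hβ : β ∈ Set.Icc (0 : ℝ) 1) (hirr : Irrational β) (n : ℕ) :
    0 < (-1) ^ n * convergentError β n ∧ (-1) ^ n * convergentError β n < 1 := by
  induction n with
  | zero =>
    have h := gaussIterate_mem hβ hirr 0
    have h0 : gaussIterate β 0 = β := rfl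
    simpa [convergentError, convergentDen, convergentNum, h0] using h
  | succ n ih =>
    have h := gaussIterate_mem hβ hirr (n + 1)
    rw [convergentError_succ hβ hirr n, pow_succ]
    constructor <;> nlinarith [mul_pos h.1 ih.1]

theorem convergentDen_pos (hβ : β ∈ Set.Icc (0 : ℝ) 1) (hirr : Irrational β) (n : ℕ) :
    1 ≤ convergentDen β n := by
  induction n using Nat.twoStepInduction with
  | zero => exact le_rfl
  | one => exact partialQuotient_pos hβ hirr 0
  | more n h1 h2 => rw [convergentDen_add_two]; omega

theorem convergentDen_add_le (hβ : β ∈ Set.Icc (0 : ℝ) 1) (hirr : Irrational β) (n : ℕ) :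
    convergentDen β (n + 1) + convergentDen β n ≤ convergentDen β (n + 2) := by
  rw [convergentDen_add_two]
  have := Nat.mul_le_mul_right (convergentDen β (n + 1)) (partialQuotient_pos hβ hirr (n + 1))
  omega

theorem le_convergentDen (hβ : β ∈ Set.Icc (0 : ℝ) 1) (hirr : Irrational β) (n : ℕ) :
    n ≤ convergentDen β n := by
  induction n using Nat.twoStepInduction with
  | zero => exact Nat.zero_le _
  | one => exact partialQuotient_pos hβ hirr 0
  | more n h1 h2 =>
    have h3 := convergentDen_add_le hβ hirr n
    have h4 := convergentDen_pos hβ hirr n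
    omega

theorem convergent_det (β : ℝ) (n : ℕ) :
    (convergentNum β (n + 1) : ℤ) * convergentDen β n - convergentNum β n * convergentDen β (n + 1)
      = (-1) ^ n := by
  induction n with
  | zero => simp [convergentNum, convergentDen]
  | succ n ih =>
    rw [convergentDen_add_two, convergentNum_add_two, pow_succ, ← ih]
    push_cast
    ring

/-- Convergents are best approximations of the second kind. -/
theorem abs_convergentError_le (hβ : β ∈ Set.Icc (0 : ℝ) 1) (hirr : Irrational β) (n : ℕ)
    {k : ℤ} (hk : k ≠ 0) (hkq : |k| < convergentDen β (n + 1)) (m : ℤ) :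
    |convergentError β n| ≤ |k * β - m| := by
  obtain ⟨x, y, hx, hy⟩ : ∃ x y : ℤ, k = x * convergentDen β n + y * convergentDen β (n + 1) ∧
      m = x * convergentNum β n + y * convergentNum β (n + 1) := by
    have hs : ((-1 : ℤ) ^ n) * (-1) ^ n = 1 := by rw [← mul_pow]; norm_num
    refine ⟨(-1) ^ n * (convergentNum β (n + 1) * k - convergentDen β (n + 1) * m),
      (-1) ^ n * (convergentDen β n * m - convergentNum β n * k), ?_, ?_⟩
    · linear_combination (-k) * hs - (-1) ^ n * k * convergent_det β n
    · linear_combination (-m) * hs - (-1) ^ n * m * convergent_det β n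
  have hq : (1 : ℤ) ≤ convergentDen β n := by exact_mod_cast convergentDen_pos hβ hirr n
  have hq' : (1 : ℤ) ≤ convergentDen β (n + 1) := by exact_mod_cast convergentDen_pos hβ hirr (n + 1)
  rw [abs_lt] at hkq
  have hx0 : x ≠ 0 := by
    rintro rfl
    have hy0 : y ≠ 0 := by rintro rfl; simp at hx; exact hk hx
    rcases lt_or_gt_of_ne hy0 with h | h <;> nlinarith
  have hxy : x * y ≤ 0 := by
    by_contra! h
    rcases pos_and_pos_or_neg_and_neg_of_mul_pos h with ⟨h1, h2⟩ | ⟨h1, h2⟩ <;> nlinarith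
  have hexp : (k : ℝ) * β - m = x * convergentError β n + y * convergentError β (n + 1) := by
    rw [hx, hy]
    simp only [convergentError]
    push_cast
    ring
  have hg := (gaussIterate_mem hβ hirr (n + 1)).1
  have hxyR : (x : ℝ) * y ≤ 0 := by exact_mod_cast hxy
  have hxR : (1 : ℝ) ≤ (x : ℝ) ^ 2 := by
    exact_mod_cast Int.one_le_abs hx0 |> fun h => (one_le_sq_iff_one_le_abs x).mpr h
  rw [hexp, convergentError_succ hβ hirr, ← sq_le_sq]
  have h1 : 1 ≤ ((x : ℝ) - y * gaussIterate β (n + 1)) ^ 2 := by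
    nlinarith [mul_nonneg hg.le (neg_nonneg.mpr hxyR), sq_nonneg ((y : ℝ) * gaussIterate β (n + 1))]
  nlinarith [mul_le_mul_of_nonneg_right h1 (sq_nonneg (convergentError β n))]

theorem floor_add_convergentDen (hβ : β ∈ Set.Icc (0 : ℝ) 1) (hirr : Irrational β) (n : ℕ)
    {k : ℤ} (hk : k ≠ 0) (hkq : |k| < convergentDen β (n + 1)) (hkn : k + convergentDen β n ≠ 0) :
    ⌊((k + convergentDen β n : ℤ) : ℝ) * β⌋ = ⌊(k : ℝ) * β⌋ + convergentNum β n := by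
  have h0 := abs_convergentError_le hβ hirr n hk hkq ⌊(k : ℝ) * β⌋
  have h1 := abs_convergentError_le hβ hirr n hk hkq (⌊(k : ℝ) * β⌋ + 1)
  have hf := Int.floor_le ((k : ℝ) * β)
  have hf' := Int.lt_floor_add_one ((k : ℝ) * β)
  have hsum : ((k + convergentDen β n : ℤ) : ℝ) * β
      = k * β + convergentNum β n + convergentError β n := by
    simp only [convergentError]
    push_cast
    ring
  have hne : ((k + convergentDen β n : ℤ) : ℝ) * β ≠ ((⌊(k : ℝ) * β⌋ + convergentNum β n + 1 : ℤ) : ℝ) :=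
    (hirr.intCast_mul hkn).ne_int _
  have hle := neg_abs_le (convergentError β n)
  have hle' := le_abs_self (convergentError β n)
  rw [abs_of_nonneg (a := (k : ℝ) * β - _) (by linarith)] at h0
  rw [abs_of_nonpos (a := (k : ℝ) * β - _) (by push_cast; linarith)] at h1
  rw [Int.floor_eq_iff]
  push_cast at *
  refine ⟨by linarith, lt_of_le_of_ne (by linarith) ?_⟩
  convert hne using 1

theorem floor_convergentDen_even (hβ : β ∈ Set.Icc (0 : ℝ) 1) (hirr : Irrational β) {n : ℕ}
    (hn : Even n) : ⌊(convergentDen β n : ℝ) * β⌋ = convergentNum β n := by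
  have h := convergentError_sign hβ hirr n
  rw [hn.neg_one_pow, one_mul, convergentError] at h
  rw [Int.floor_eq_iff]
  push_cast
  constructor <;> linarith [h.1, h.2]

theorem floor_convergentDen_odd (hβ : β ∈ Set.Icc (0 : ℝ) 1) (hirr : Irrational β) {n : ℕ}
    (hn : Odd n) : ⌊(convergentDen β n : ℝ) * β⌋ = (convergentNum β n : ℤ) - 1 := by
  have h := convergentError_sign hβ hirr n
  rw [hn.neg_one_pow, convergentError] at h
  rw [Int.floor_eq_iff]
  push_cast
  constructor <;> linarith [h.1, h.2]

theorem sturmian_add_convergentDen (hβ : β ∈ Set.Icc (0 : ℝ) 1) (hirr : Irrational β) (n : ℕ)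
    {k : ℤ} (hk : 1 ≤ k) (hkq : k + 2 ≤ convergentDen β (n + 1)) :
    sturmian β (k + convergentDen β n) = sturmian β k := by
  have h1 := floor_add_convergentDen hβ hirr n (k := k) (by omega)
    (by rw [abs_of_nonneg] <;> omega) (by omega)
  have h2 := floor_add_convergentDen hβ hirr n (k := k + 1) (by omega)
    (by rw [abs_of_nonneg] <;> omega) (by omega)
  have h3 : (((k + convergentDen β n : ℤ) : ℝ) + 1) = ((k + 1 + convergentDen β n : ℤ) : ℝ) := by
    push_cast; ring
  rw [sturmian, sturmian, h3, h2, h1]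
  push_cast
  ring

theorem sturmian_add_convergentDen_of_even (hβ : β ∈ Set.Icc (0 : ℝ) 1) (hirr : Irrational β)
    {n : ℕ} (hn : Even n) {k : ℤ} (hk : -(convergentDen β n : ℤ) < k)
    (hkq : k + 2 ≤ convergentDen β (n + 1)) (hq : convergentDen β n ≤ convergentDen β (n + 1)) :
    sturmian β (k + convergentDen β n) = sturmian β k := by
  have key : ∀ j : ℤ, -(convergentDen β n : ℤ) < j → j + 1 ≤ convergentDen β (n + 1) →
      ⌊((j + convergentDen β n : ℤ) : ℝ) * β⌋ = ⌊(j : ℝ) * β⌋ + convergentNum β n := by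
    intro j hj hj'
    rcases eq_or_ne j 0 with rfl | h0
    · simpa using floor_convergentDen_even hβ hirr hn
    · exact floor_add_convergentDen hβ hirr n h0 (by rw [abs_lt]; omega) (by omega)
  have h3 : (((k + convergentDen β n : ℤ) : ℝ) + 1) = ((k + 1 + convergentDen β n : ℤ) : ℝ) := by
    push_cast; ring
  rw [sturmian, sturmian, h3, key (k + 1) (by omega) (by omega), key k hk (by omega)]
  push_cast
  ring

theorem floor_one_add_convergentDen (hβ : β ∈ Set.Icc (0 : ℝ) 1) (hirr : Irrational β) (n : ℕ) :
    ⌊((convergentDen β (n + 1) : ℝ) + 1) * β⌋ = convergentNum β (n + 1) := by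
  have h := floor_add_convergentDen hβ hirr (n + 1) (k := 1) one_ne_zero (by
    have := convergentDen_add_le hβ hirr n
    have := convergentDen_pos hβ hirr n
    have := convergentDen_pos hβ hirr (n + 1)
    rw [abs_one]
    have h : 1 < convergentDen β (n + 2) := by omega
    exact_mod_cast h) (by omega)
  have h0 : ⌊β⌋ = 0 := by
    have := gaussIterate_mem hβ hirr 0
    exact Int.floor_eq_zero_iff.mpr ⟨this.1.le, this.2⟩
  have h1 : ((1 + convergentDen β (n + 1) : ℤ) : ℝ) = (convergentDen β (n + 1) : ℝ) + 1 := by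
    push_cast; ring
  rw [h1] at h
  rw [h]
  simp [h0]

theorem sturmian_convergentDen_even (hβ : β ∈ Set.Icc (0 : ℝ) 1) (hirr : Irrational β) {n : ℕ}
    (hn : Even (n + 1)) : sturmian β (convergentDen β (n + 1)) = 0 := by
  have h1 := floor_one_add_convergentDen hβ hirr n
  have h2 := floor_convergentDen_even hβ hirr hn
  rw [sturmian, Int.cast_natCast, h1, h2, sub_self]

theorem sturmian_convergentDen_odd (hβ : β ∈ Set.Icc (0 : ℝ) 1) (hirr : Irrational β) {n : ℕ}
    (hn : Odd (n + 1)) : sturmian β (convergentDen β (n + 1)) = 1 := by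
  have h1 := floor_one_add_convergentDen hβ hirr n
  have h2 := floor_convergentDen_odd hβ hirr hn
  rw [sturmian, Int.cast_natCast, h1, h2]
  ring

theorem sturmian_eq_zero_of_lt (hβ : β ∈ Set.Icc (0 : ℝ) 1) (hirr : Irrational β) {k : ℤ}
    (hk : 1 ≤ k) (hkq : k < convergentDen β 1) : sturmian β k = 0 := by
  have h := floor_add_convergentDen hβ hirr 0 (k := k) (by omega)
    (by rw [abs_of_nonneg] <;> omega) (by simp [convergentDen]; omega)
  have h1 : ((k + convergentDen β 0 : ℤ) : ℝ) = (k : ℝ) + 1 := by simp [convergentDen]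
  rw [h1] at h
  simp [sturmian, h, convergentNum]

theorem sturmian_eq_zero_or_one (hβ : β ∈ Set.Icc (0 : ℝ) 1) (hirr : Irrational β) (k : ℤ) :
    sturmian β k = 0 ∨ sturmian β k = 1 := by
  have h := gaussIterate_mem hβ hirr 0
  have h0 : gaussIterate β 0 = β := rfl
  rw [h0] at h
  have h1 : ⌊(k : ℝ) * β⌋ ≤ ⌊((k : ℝ) + 1) * β⌋ := Int.floor_le_floor (by nlinarith)
  have h2 : ⌊((k : ℝ) + 1) * β⌋ ≤ ⌊(k : ℝ) * β⌋ + 1 := by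
    rw [← Int.floor_add_one]
    exact Int.floor_le_floor (by nlinarith)
  simp only [sturmian]
  omega

theorem hopping_pos (hβ : β ∈ Set.Icc (0 : ℝ) 1) (hirr : Irrational β) {lam₁ lam₂ : ℝ}
    (h₁ : 0 < lam₁) (h₂ : 0 < lam₂) (k : ℤ) : 0 < hopping β lam₁ lam₂ k := by
  rcases sturmian_eq_zero_or_one hβ hirr k with h | h <;> simp [hopping, h, h₁, h₂]

end Irrational

/-! ## Escape and boundedness for the trace map -/

/-- The relations satisfied by the traces `x n = Tr B_n` and `t n p = Tr (A_n B_n ^ p)`, where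
`A_{n+1} = B_n` and `B_{n+1} = A_n B_n ^ (a n)` have determinant one. -/
structure IsTraceOrbit (a : ℕ → ℕ) (x : ℕ → ℝ) (t : ℕ → ℕ → ℝ) : Prop where
  one_le : ∀ n, 1 ≤ a n
  add_two : ∀ n p, t n (p + 2) = x n * t n (p + 1) - t n p
  next : ∀ n, x (n + 1) = t n (a n)
  next_zero : ∀ n, t (n + 1) 0 = x n
  next_one : ∀ n, t (n + 1) 1 = t n (a n + 1)

/-- The escape condition at stage `n` of a trace orbit. -/
def Escaped (x : ℕ → ℝ) (t : ℕ → ℕ → ℝ) (n : ℕ) : Prop :=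
  2 < |x n| ∧ 2 < |t n 1| ∧ |t n 0| < |t n 1|

theorem abs_lt_abs_of_recurrence {f : ℕ → ℝ} {x : ℝ} (hf : ∀ p, f (p + 2) = x * f (p + 1) - f p)
    (hx : 2 < |x|) {k : ℕ} (hk : |f k| < |f (k + 1)|) {j : ℕ} (hj : k ≤ j) :
    |f j| < |f (j + 1)| := by
  induction j, hj using Nat.le_induction with
  | base => exact hk
  | succ j _ ih =>
    have h1 : |x * f (j + 1)| - |f j| ≤ |f (j + 2)| := by
      rw [hf]; exact abs_sub_abs_le_abs_sub _ _
    rw [abs_mul] at h1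
    change |f (j + 1)| < |f (j + 2)|
    nlinarith [abs_nonneg (f j)]

namespace IsTraceOrbit

variable {a : ℕ → ℕ} {x : ℕ → ℝ} {t : ℕ → ℕ → ℝ}

theorem escaped_succ_of_lt (h : IsTraceOrbit a x t) {n k : ℕ} (hx : 2 < |x n|) (hk : k < a n)
    (hlt : |t n k| < |t n (k + 1)|) (hx' : 2 < |x (n + 1)|) :
    Escaped x t (n + 1) ∧ (|x n| - 1) * |x (n + 1)| ≤ |t (n + 1) 1| := by
  obtain ⟨j, hj⟩ : ∃ j, a n = j + 1 := ⟨a n - 1, by omega⟩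
  have h1 := abs_lt_abs_of_recurrence (h.add_two n) hx hlt (j := j) (by omega)
  have h2 : |x n * t n (j + 1)| - |t n j| ≤ |t n (j + 2)| := by
    rw [h.add_two]; exact abs_sub_abs_le_abs_sub _ _
  have e1 : t (n + 1) 1 = t n (j + 2) := by rw [h.next_one, hj]
  have e2 : x (n + 1) = t n (j + 1) := by rw [h.next, hj]
  rw [abs_mul] at h2
  have h3 : (|x n| - 1) * |x (n + 1)| ≤ |t (n + 1) 1| := by
    rw [e1, e2]; nlinarith
  have h4 : |x n| < |t (n + 1) 1| := by nlinarith
  exact ⟨⟨hx', by linarith, by rwa [h.next_zero]⟩, h3⟩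

theorem le_of_escaped (h : IsTraceOrbit a x t) {n : ℕ} (he : Escaped x t n) :
    |t n 1| ≤ |x (n + 1)| := by
  have key : ∀ j, |t n 1| ≤ |t n (j + 1)| := by
    intro j
    induction j with
    | zero => exact le_rfl
    | succ j ih =>
      exact ih.trans (abs_lt_abs_of_recurrence (h.add_two n) he.1 he.2.2 (Nat.zero_le (j + 1))).le
  have ha := h.one_le n
  obtain ⟨j, hj⟩ : ∃ j, a n = j + 1 := ⟨a n - 1, by omega⟩
  rw [h.next, hj]
  exact key j

theorem escaped_succ (h : IsTraceOrbit a x t) {n : ℕ} (he : Escaped x t n) :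
    Escaped x t (n + 1) ∧ (|x n| - 1) * |t n 1| ≤ |t (n + 1) 1| := by
  have h1 := h.le_of_escaped he
  have h2 := h.escaped_succ_of_lt he.1 (h.one_le n) he.2.2 (he.2.1.trans_le h1)
  exact ⟨h2.1, le_trans (mul_le_mul_of_nonneg_left h1 (by linarith [he.1])) h2.2⟩

theorem escaped_of_le (h : IsTraceOrbit a x t) {n m : ℕ} (he : Escaped x t n) (hm : n ≤ m) :
    Escaped x t m := by
  induction m, hm using Nat.le_induction with
  | base => exact he
  | succ m _ ih => exact (h.escaped_succ ih).1

theorem not_bounded_of_escaped (h : IsTraceOrbit a x t) {n : ℕ} (he : Escaped x t n) (C : ℝ) :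
    ∃ m, n ≤ m ∧ C < |x m| := by
  set c := |t n 1| with hc
  have hc2 : 2 < c := he.2.1
  have hesc : ∀ j, Escaped x t (n + j) := fun j => h.escaped_of_le he (Nat.le_add_right n j)
  have hle : ∀ j, c ≤ |t (n + j) 1| := by
    intro j
    induction j with
    | zero => exact le_rfl
    | succ j ih =>
      have := (h.escaped_succ (hesc j)).2
      change c ≤ |t (n + j + 1) 1|
      nlinarith [(hesc j).1]
  have hgrow : ∀ j, (c - 1) ^ j ≤ |t (n + 1 + j) 1| := by
    intro j
    induction j with
    | zero => have := hle 1; simp only [pow_zero, add_zero]; linarith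
    | succ j ih =>
      have e : n + 1 + j = n + (j + 1) := by ring
      have h1 := (h.escaped_succ (hesc (j + 1))).2
      have h2 := h.le_of_escaped (hesc j)
      have h3 := hle j
      rw [← add_assoc, show n + j + 1 = n + 1 + j by ring] at h1
      rw [show n + j + 1 = n + 1 + j by ring] at h2
      rw [pow_succ]
      change _ ≤ |t (n + 1 + j + 1) 1|
      have h4 : 0 ≤ (c - 1) ^ j := pow_nonneg (by linarith) j
      nlinarith
  obtain ⟨j, hj⟩ := pow_unbounded_of_one_lt C (show 1 < c - 1 by linarith)
  refine ⟨n + 1 + j + 1, by omega, hj.trans_le ((hgrow j).trans (h.le_of_escaped ?_))⟩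
  exact h.escaped_of_le he (by omega)

theorem abs_le_of_not_escaped (h : IsTraceOrbit a x t) {n : ℕ} (hne : ¬ Escaped x t (n + 1))
    (hx : 2 < |x n|) (hx' : 2 < |x (n + 1)|) {k : ℕ} (hk : k < a n) :
    |t n (k + 1)| ≤ |t n k| := by
  by_contra! hlt
  exact hne (h.escaped_succ_of_lt hx hk hlt hx').1

theorem abs_next_le_of_not_escaped (h : IsTraceOrbit a x t) {n : ℕ} (hne : ¬ Escaped x t (n + 1))
    (hx : 2 < |x n|) (hx' : 2 < |x (n + 1)|) {k : ℕ} (hk : k ≤ a n) :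
    |x (n + 1)| ≤ |t n k| := by
  rw [h.next]
  refine Nat.decreasingInduction (motive := fun k _ => |t n (a n)| ≤ |t n k|)
    (fun k hk ih => ih.trans (h.abs_le_of_not_escaped hne hx hx' hk)) le_rfl hk

/-- The Fricke–Vogt quantity is preserved along a trace orbit. -/
theorem invariant (h : IsTraceOrbit a x t) (n : ℕ) :
    x n ^ 2 + t n 0 ^ 2 + t n 1 ^ 2 - x n * t n 0 * t n 1
      = x 0 ^ 2 + t 0 0 ^ 2 + t 0 1 ^ 2 - x 0 * t 0 0 * t 0 1 := by
  have key : ∀ n p, x n ^ 2 + t n p ^ 2 + t n (p + 1) ^ 2 - x n * t n p * t n (p + 1)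
      = x n ^ 2 + t n 0 ^ 2 + t n 1 ^ 2 - x n * t n 0 * t n 1 := by
    intro n p
    induction p with
    | zero => rfl
    | succ p ih =>
      rw [← ih]
      change x n ^ 2 + t n (p + 1) ^ 2 + t n (p + 2) ^ 2 - x n * t n (p + 1) * t n (p + 2) = _
      rw [h.add_two]
      ring
  induction n with
  | zero => rfl
  | succ n ih =>
    rw [← ih, ← key n (a n), h.next, h.next_zero, h.next_one]
    ring

/-- An orbit that never escapes and once meets `[-2, 2]` is bounded and keeps returning there. -/
theorem bounded_of_not_escaped (h : IsTraceOrbit a x t) (hne : ∀ n, ¬ Escaped x t n) {m : ℕ}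
    (hm : |x m| ≤ 2) :
    ∃ C, ∀ n, m ≤ n → |x n| ≤ C ∧ (|x n| ≤ 2 ∨ |x (n + 1)| ≤ 2) := by
  set I := x 0 ^ 2 + t 0 0 ^ 2 + t 0 1 ^ 2 - x 0 * t 0 0 * t 0 1 with hI
  have hpos := abs_nonneg I
  have key : ∀ n, |x n| ≤ 2 → 2 < |x (n + 1)| → |x (n + 1)| ≤ 4 + |I| ∧ |x (n + 2)| ≤ 2 := by
    intro n h1 h2
    constructor
    · have hinv := h.invariant (n + 1)
      rw [← hI, h.next_zero] at hinv
      have hv : |t (n + 1) 1| ≤ 2 := by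
        by_contra! hv
        refine hne (n + 1) ⟨h2, hv, ?_⟩
        rw [h.next_zero]
        linarith
      have h3 : |x (n + 1) * x n * t (n + 1) 1| ≤ |x (n + 1)| * 4 := by
        rw [mul_assoc, abs_mul, abs_mul]
        refine mul_le_mul_of_nonneg_left ?_ (abs_nonneg _)
        nlinarith [abs_nonneg (x n), abs_nonneg (t (n + 1) 1)]
      have h4 := le_abs_self (x (n + 1) * x n * t (n + 1) 1)
      have h5 := le_abs_self I
      have h6 : |x (n + 1)| ^ 2 ≤ |x (n + 1)| * 4 + |I| := by
        rw [sq_abs]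
        nlinarith [sq_nonneg (x n), sq_nonneg (t (n + 1) 1)]
      by_contra! h7
      nlinarith
    · by_contra! h3
      have h4 := h.abs_next_le_of_not_escaped (hne (n + 2)) h2 h3 (Nat.zero_le _)
      rw [h.next_zero] at h4
      change |x (n + 2)| ≤ _ at h4
      linarith
  have main : ∀ n, m ≤ n → |x n| ≤ 2 ∨ (|x n| ≤ 4 + |I| ∧ |x (n + 1)| ≤ 2) := by
    intro n hn
    induction n, hn using Nat.le_induction with
    | base => exact Or.inl hm
    | succ n _ ih =>
      rcases ih with ih | ih
      · rcases le_or_gt |x (n + 1)| 2 with h1 | h1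
        · exact Or.inl h1
        · exact Or.inr (key n ih h1)
      · exact Or.inl ih.2
  refine ⟨4 + |I|, fun n hn => ?_⟩
  rcases main n hn with h1 | h1
  · exact ⟨by linarith, Or.inl h1⟩
  · exact ⟨h1.1, Or.inr h1.2⟩

/-- An orbit with the initial traces of the off-diagonal model escapes or starts in `[-2, 2]`. -/
theorem exists_abs_le_two (h : IsTraceOrbit a x t) (hne : ∀ n, ¬ Escaped x t n)
    {E l₁ l₂ : ℝ} (h₁ : 0 < l₁) (h₂ : 0 < l₂) (hx : x 0 = E / l₂)
    (hu : t 0 0 = l₁ / l₂ + l₂ / l₁) (hv : t 0 1 = E / l₁) :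
    |x 0| ≤ 2 ∨ |x 1| ≤ 2 := by
  by_contra! hc
  obtain ⟨hx0, hx1⟩ := hc
  have hu1 := h.abs_next_le_of_not_escaped (hne 1) hx0 hx1 (h.one_le 0)
  have hE : 0 < |E| := by
    rw [abs_pos]; rintro rfl; rw [hx] at hx0; norm_num at hx0
  have hmono := h.abs_le_of_not_escaped (hne 1) hx0 hx1 (h.one_le 0)
  have ht2 := h.add_two 0 0
  simp only [zero_add] at ht2 hmono hu1
  set e := |E| / l₁ with he
  set y := |E| / l₂ with hy
  have hepos : 0 < e := by positivity
  have hypos : 0 < y := by positivity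
  have hxy : |x 0| = y := by rw [hx, abs_div, abs_of_pos h₂]
  have hte : |t 0 1| = e := by rw [hv, abs_div, abs_of_pos h₁]
  have hu' : t 0 0 = y / e + e / y := by
    rw [hu, he, hy]; field_simp
  have hupos : 0 < t 0 0 := by rw [hu]; positivity
  have hy2 : 2 < y := hxy ▸ hx0
  have he2 : 2 < e := hte ▸ hx1.trans_le hu1
  have hle : e ≤ y / e + e / y := by
    rw [← hu', ← hte, ← abs_of_pos hupos]; exact hmono
  have h3 : y * e - (y / e + e / y) ≤ |t 0 2| := by
    rw [ht2, ← hu', ← hxy, ← hte, ← abs_mul]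
    nth_rewrite 1 [← abs_of_pos hupos]
    exact abs_sub_abs_le_abs_sub _ _
  have hye : e ≤ y := by
    by_contra! hlt
    have h4 : y / e < 1 := (div_lt_one hepos).mpr hlt
    have h5 : e / y < e / 2 := div_lt_div_of_pos_left hepos (by norm_num) hy2
    linarith
  have h6 : e / y ≤ 1 := (div_le_one hypos).mpr hye
  have h7 : y / e < y / 2 := div_lt_div_of_pos_left hypos (by norm_num) he2
  have h8 : y < |t 0 2| := by
    have h9 : y / e = y * e⁻¹ := div_eq_mul_inv _ _
    have h10 : e * e⁻¹ = 1 := mul_inv_cancel₀ hepos.ne'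
    have h11 : 0 < e⁻¹ := inv_pos.mpr hepos
    have h12 : e⁻¹ < 1 / 2 := by rw [inv_lt_comm₀ hepos (by norm_num)]; linarith
    have h13 : e * (e - 1 - e⁻¹) ≤ y * (e - 1 - e⁻¹) :=
      mul_le_mul_of_nonneg_right hye (by linarith)
    nlinarith
  rcases (h.one_le 0).eq_or_lt with ha | ha
  · refine hne 1 ⟨hx1, ?_, ?_⟩
    · rw [h.next_one, ← ha]; exact hy2.trans h8
    · rw [h.next_one, h.next_zero, ← ha, hxy]; exact h8
  · have := h.abs_le_of_not_escaped (hne 1) hx0 hx1 ha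
    simp only [Nat.reduceAdd] at this
    linarith

end IsTraceOrbit

/-! ## Products of step matrices -/

theorem det_stepMatrix {a : ℝ} (ha : a ≠ 0) (E : ℝ) : (stepMatrix a E).det = 1 := by
  simp only [stepMatrix, Matrix.det_smul, Matrix.det_fin_two_of, Fintype.card_fin]
  field_simp
  ring

theorem trace_stepMatrix (a E : ℝ) : (stepMatrix a E).trace = E / a := by
  simp [stepMatrix, Matrix.trace_fin_two, div_eq_inv_mul]

theorem det_transferProduct {a : ℤ → ℝ} (ha : ∀ k, a k ≠ 0) (E : ℝ) (n : ℕ) :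
    (transferProduct a E n).det = 1 := by
  induction n with
  | zero => exact Matrix.det_one
  | succ n ih => rw [transferProduct, Matrix.det_mul, ih, det_stepMatrix (ha _), one_mul]

theorem transferProduct_add (a : ℤ → ℝ) (E : ℝ) (m n : ℕ) :
    transferProduct a E (n + m)
      = transferProduct (fun k => a (k + m)) E n * transferProduct a E m := by
  induction n with
  | zero => simp [transferProduct]
  | succ n ih =>
    rw [show n + 1 + m = n + m + 1 by ring, transferProduct, ih, transferProduct, mul_assoc]
    congr 3
    push_cast
    ring_nf

theorem transferProduct_congr {a b : ℤ → ℝ} (E : ℝ) {n : ℕ}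
    (h : ∀ k : ℤ, 1 ≤ k → k ≤ n → a k = b k) : transferProduct a E n = transferProduct b E n := by
  induction n with
  | zero => rfl
  | succ n ih =>
    rw [transferProduct, transferProduct, h (n + 1) (by omega) (by push_cast; omega),
      ih fun k h1 h2 => h k h1 (by push_cast; omega)]

theorem transferProduct_const (c E : ℝ) (n : ℕ) :
    transferProduct (fun _ => c) E n = stepMatrix c E ^ n := by
  induction n with
  | zero => rfl
  | succ n ih => rw [transferProduct, ih, pow_succ']

theorem transferProduct_add_mul {a : ℤ → ℝ} (E : ℝ) {q N : ℕ}
    (h : ∀ k : ℤ, 1 ≤ k → k + q ≤ N → a (k + q) = a k) (r j : ℕ) (hN : r + j * q ≤ N) :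
    transferProduct a E (r + j * q) = transferProduct a E r * transferProduct a E q ^ j := by
  induction j with
  | zero => simp
  | succ j ih =>
    have e : r + (j + 1) * q = r + j * q + q := by ring
    rw [e] at hN ⊢
    rw [transferProduct_add, transferProduct_congr (b := a), ih (by omega), pow_succ, mul_assoc]
    intro k h1 h2
    refine h k h1 ?_
    push_cast at h2
    zify at hN
    linarith

theorem sq_eq_of_det_eq_one {R : Type*} [CommRing R] {B : Matrix (Fin 2) (Fin 2) R} (hB : B.det = 1) :
    B * B = B.trace • B - 1 := by
  rw [Matrix.det_fin_two] at hB
  ext i j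
  fin_cases i <;> fin_cases j <;>
    simp [Matrix.mul_apply, Fin.sum_univ_two, Matrix.trace_fin_two]
  · linear_combination -hB
  · ring
  · ring
  · linear_combination -hB

theorem trace_mul_pow_add_two {A B : Matrix (Fin 2) (Fin 2) ℝ} (hB : B.det = 1) (p : ℕ) :
    (A * B ^ (p + 2)).trace = B.trace * (A * B ^ (p + 1)).trace - (A * B ^ p).trace := by
  have h : A * B ^ (p + 2) = B.trace • (A * B ^ (p + 1)) - A * B ^ p := by
    rw [pow_add, pow_two, sq_eq_of_det_eq_one hB, mul_sub, mul_one, mul_sub, mul_smul_comm,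
      mul_smul_comm, pow_succ]
  rw [h, Matrix.trace_sub, Matrix.trace_smul, smul_eq_mul]

/-! ## The renormalization of the transfer matrices -/

/-- The pairs `(A_n, B_n)` with `B_0` the transfer matrix over the letter `l₂`, `A_0 B_0` the one
over `l₁`, `A_{n+1} = B_n` and `B_{n+1} = A_n B_n ^ a_{n+1}`. -/
def blockPair (β l₁ l₂ E : ℝ) : ℕ → Matrix (Fin 2) (Fin 2) ℝ × Matrix (Fin 2) (Fin 2) ℝ
  | 0 => (stepMatrix l₁ E * (stepMatrix l₂ E).adjugate, stepMatrix l₂ E)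
  | n + 1 => ((blockPair β l₁ l₂ E n).2,
      (blockPair β l₁ l₂ E n).1 * (blockPair β l₁ l₂ E n).2 ^ partialQuotient β n)

/-- The trace of the second matrix in `blockPair`. -/
def blockTrace (β l₁ l₂ E : ℝ) (n : ℕ) : ℝ := (blockPair β l₁ l₂ E n).2.trace

/-- The traces `Tr (A_n B_n ^ p)` of the matrices in `blockPair`. -/
def mixedTrace (β l₁ l₂ E : ℝ) (n p : ℕ) : ℝ :=
  ((blockPair β l₁ l₂ E n).1 * (blockPair β l₁ l₂ E n).2 ^ p).trace

section

variable {β l₁ l₂ : ℝ}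

theorem det_blockPair (β : ℝ) (h₁ : 0 < l₁) (h₂ : 0 < l₂) (E : ℝ) (n : ℕ) :
    (blockPair β l₁ l₂ E n).1.det = 1 ∧ (blockPair β l₁ l₂ E n).2.det = 1 := by
  induction n with
  | zero => simp [blockPair, Matrix.det_adjugate, det_stepMatrix h₁.ne', det_stepMatrix h₂.ne']
  | succ n ih => simp [blockPair, Matrix.det_mul, Matrix.det_pow, ih.1, ih.2]

theorem isTraceOrbit_blockTrace (hβ : β ∈ Set.Icc (0 : ℝ) 1) (hirr : Irrational β)
    (h₁ : 0 < l₁) (h₂ : 0 < l₂) (E : ℝ) :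
    IsTraceOrbit (partialQuotient β) (blockTrace β l₁ l₂ E) (mixedTrace β l₁ l₂ E) where
  one_le := partialQuotient_pos hβ hirr
  add_two n p := trace_mul_pow_add_two (det_blockPair β h₁ h₂ E n).2 p
  next n := rfl
  next_zero n := by simp [mixedTrace, blockTrace, blockPair]
  next_one n := by
    simp only [mixedTrace, blockPair, pow_one]
    rw [Matrix.trace_mul_comm, mul_assoc, ← pow_succ]

theorem mixedTrace_zero_zero (β : ℝ) (h₁ : 0 < l₁) (h₂ : 0 < l₂) (E : ℝ) :
    mixedTrace β l₁ l₂ E 0 0 = l₁ / l₂ + l₂ / l₁ := by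
  simp [mixedTrace, blockPair, stepMatrix, Matrix.adjugate_fin_two, Matrix.trace_fin_two]
  field_simp
  ring

theorem mixedTrace_zero_one (β : ℝ) (h₂ : 0 < l₂) (E : ℝ) :
    mixedTrace β l₁ l₂ E 0 1 = E / l₁ := by
  simp only [mixedTrace, blockPair, pow_one]
  rw [mul_assoc, Matrix.adjugate_mul, det_stepMatrix h₂.ne', one_smul, mul_one, trace_stepMatrix]

theorem blockPair_one (hβ : β ∈ Set.Icc (0 : ℝ) 1) (hirr : Irrational β) (h₂ : 0 < l₂) (E : ℝ) :
    (blockPair β l₁ l₂ E 1).2 = transferMatrix β l₁ l₂ E 1 := by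
  obtain ⟨m, hm⟩ : ∃ m, convergentDen β 1 = m + 1 :=
    ⟨_, (Nat.sub_add_cancel (convergentDen_pos hβ hirr 1)).symm⟩
  have hlast := sturmian_convergentDen_odd hβ hirr (n := 0) (by decide)
  have hfirst : transferProduct (hopping β l₁ l₂) E m = stepMatrix l₂ E ^ m := by
    rw [← transferProduct_const]
    refine transferProduct_congr E fun k h1 h2 => ?_
    simp [hopping, sturmian_eq_zero_of_lt hβ hirr h1 (by omega)]
  simp only [zero_add, hm] at hlast
  push_cast at hlast
  rw [transferMatrix, hm, transferProduct, hfirst]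
  change stepMatrix l₁ E * (stepMatrix l₂ E).adjugate * stepMatrix l₂ E ^ convergentDen β 1 = _
  rw [hm, pow_succ', mul_assoc, ← mul_assoc (Matrix.adjugate _), Matrix.adjugate_mul,
    det_stepMatrix h₂.ne', one_smul, one_mul]
  simp [hopping, hlast]

theorem transferMatrix_add_two (hβ : β ∈ Set.Icc (0 : ℝ) 1) (hirr : Irrational β) (E : ℝ) (n : ℕ)
    (hq : 2 ≤ convergentDen β (n + 1)) :
    transferMatrix β l₁ l₂ E (n + 2) = transferMatrix β l₁ l₂ E n
      * transferMatrix β l₁ l₂ E (n + 1) ^ partialQuotient β (n + 1) := by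
  have hper : ∀ k : ℤ, 1 ≤ k → k + convergentDen β (n + 1) ≤ convergentDen β (n + 2) →
      hopping β l₁ l₂ (k + convergentDen β (n + 1)) = hopping β l₁ l₂ k := by
    intro k h1 h2
    rw [hopping, hopping,
      sturmian_add_convergentDen hβ hirr (n + 1) h1 (by change _ ≤ ((convergentDen β (n + 2) : ℕ) : ℤ); omega)]
  simp only [transferMatrix]
  rw [← transferProduct_add_mul E hper, convergentDen_add_two, add_comm]
  rw [convergentDen_add_two, add_comm]

theorem blockPair_succ_eq (hβ : β ∈ Set.Icc (0 : ℝ) 1) (hirr : Irrational β) (h₂ : 0 < l₂)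
    (E : ℝ) (n : ℕ) : (blockPair β l₁ l₂ E (n + 1)).2 = transferMatrix β l₁ l₂ E (n + 1) := by
  induction n using Nat.twoStepInduction with
  | zero => exact blockPair_one hβ hirr h₂ E
  | one =>
    change stepMatrix l₂ E * (blockPair β l₁ l₂ E 1).2 ^ partialQuotient β 1 = _
    rw [blockPair_one hβ hirr h₂ E]
    rcases (convergentDen_pos hβ hirr 1).eq_or_lt with hq | hq
    · have h2 : convergentDen β 2 = partialQuotient β 1 + 1 := by
        have h := convergentDen_add_two β 0
        simp only [zero_add, ← hq, mul_one] at h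
        exact h
      have hlast := sturmian_convergentDen_even hβ hirr (n := 1) (by decide)
      simp only [Nat.reduceAdd, h2] at hlast
      push_cast at hlast
      have hrep := transferProduct_add_mul (a := hopping β l₁ l₂) E (q := 1)
        (N := partialQuotient β 1) (fun k h1 h3 => by
          have h4 := sturmian_add_convergentDen hβ hirr 1 h1 (by
            change _ ≤ ((convergentDen β 2 : ℕ) : ℤ); rw [h2]; push_cast at *; omega)
          rw [← hq] at h4
          rw [hopping, hopping, h4]) 0 (partialQuotient β 1) (by omega)
      rw [zero_add, mul_one] at hrep
      rw [transferMatrix, transferMatrix, h2, ← hq,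
        show transferProduct (hopping β l₁ l₂) E (partialQuotient β 1 + 1) = _ * _ from rfl, hrep]
      simp [hopping, hlast, transferProduct]
    · rw [transferMatrix_add_two hβ hirr E 0 hq]
      have h1 := sturmian_eq_zero_of_lt hβ hirr (k := 1) le_rfl (by exact_mod_cast hq)
      congr 1
      simp [transferMatrix, convergentDen, transferProduct, hopping, h1]
  | more n ih1 ih2 =>
    have hq := le_convergentDen hβ hirr (n + 2)
    rw [transferMatrix_add_two hβ hirr E (n + 1) (le_trans (by omega) hq), ← ih1, ← ih2]
    rfl

theorem blockTrace_eq_traceSeq (hβ : β ∈ Set.Icc (0 : ℝ) 1) (hirr : Irrational β) (h₂ : 0 < l₂)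
    (E : ℝ) {n : ℕ} (hn : 1 ≤ n) : blockTrace β l₁ l₂ E n = traceSeq β l₁ l₂ E n := by
  obtain ⟨m, rfl⟩ : ∃ m, n = m + 1 := ⟨n - 1, by omega⟩
  rw [blockTrace, blockPair_succ_eq hβ hirr h₂, traceSeq]

theorem continuous_stepMatrix (a : ℝ) : Continuous (stepMatrix a) := by
  refine continuous_matrix fun i j => ?_
  fin_cases i <;> fin_cases j <;> simp [stepMatrix] <;> fun_prop

theorem continuous_blockPair (β l₁ l₂ : ℝ) (n : ℕ) :
    Continuous fun E => blockPair β l₁ l₂ E n := by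
  induction n with
  | zero =>
    exact ((continuous_stepMatrix l₁).matrix_mul (continuous_stepMatrix l₂).matrix_adjugate).prodMk
      (continuous_stepMatrix l₂)
  | succ n ih => exact ih.snd.prodMk (ih.fst.matrix_mul (ih.snd.pow _))

theorem continuous_blockTrace (β l₁ l₂ : ℝ) (n : ℕ) : Continuous fun E => blockTrace β l₁ l₂ E n :=
  (continuous_blockPair β l₁ l₂ n).snd.matrix_trace

theorem continuous_mixedTrace (β l₁ l₂ : ℝ) (n p : ℕ) :
    Continuous fun E => mixedTrace β l₁ l₂ E n p :=
  ((continuous_blockPair β l₁ l₂ n).fst.matrix_mul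
    ((continuous_blockPair β l₁ l₂ n).snd.pow p)).matrix_trace

open Filter Topology in
/-- Outside the pseudo-spectrum the traces eventually leave `[-2, 2]`, locally uniformly in the
energy; on the pseudo-spectrum they return to `[-2, 2]` infinitely often. -/
theorem traceSeq_dichotomy (hβ : β ∈ Set.Icc (0 : ℝ) 1) (hirr : Irrational β)
    (h₁ : 0 < l₁) (h₂ : 0 < l₂) (E : ℝ) :
    (E ∉ pseudoSpectrum β l₁ l₂ ∧
      ∃ N, ∀ᶠ E' in 𝓝 E, ∀ n, N ≤ n → 2 < |traceSeq β l₁ l₂ E' n|) ∨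
    (E ∈ pseudoSpectrum β l₁ l₂ ∧ ∀ N, ∃ n, N ≤ n ∧ |traceSeq β l₁ l₂ E n| ≤ 2) := by
  have horb := isTraceOrbit_blockTrace hβ hirr h₁ h₂
  by_cases he : ∃ n, Escaped (blockTrace β l₁ l₂ E) (mixedTrace β l₁ l₂ E) n
  · obtain ⟨n, hn⟩ := he
    left
    constructor
    · rintro ⟨C, hC⟩
      obtain ⟨m, hm, hCm⟩ := (horb E).not_bounded_of_escaped
        ((horb E).escaped_of_le hn (Nat.le_succ n)) C
      rw [blockTrace_eq_traceSeq hβ hirr h₂ E (by omega)] at hCm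
      exact (hC m).not_gt hCm
    · refine ⟨n + 1, ?_⟩
      have hopen : ∀ᶠ E' in 𝓝 E, Escaped (blockTrace β l₁ l₂ E') (mixedTrace β l₁ l₂ E') n := by
        have c1 := (continuous_blockTrace β l₁ l₂ n).abs
        have c2 := (continuous_mixedTrace β l₁ l₂ n 1).abs
        have c3 := (continuous_mixedTrace β l₁ l₂ n 0).abs
        exact ((continuous_const.tendsto E).eventually_lt (c1.tendsto E) hn.1).and
          (((continuous_const.tendsto E).eventually_lt (c2.tendsto E) hn.2.1).and
            ((c3.tendsto E).eventually_lt (c2.tendsto E) hn.2.2))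
      filter_upwards [hopen] with E' hE' m hm
      rw [← blockTrace_eq_traceSeq hβ hirr h₂ E' (by omega)]
      exact ((horb E').escaped_of_le hE' (by omega)).1
  · push Not at he
    right
    obtain ⟨m, hm⟩ : ∃ m, |blockTrace β l₁ l₂ E m| ≤ 2 := by
      rcases (horb E).exists_abs_le_two he h₁ h₂ (trace_stepMatrix l₂ E)
        (mixedTrace_zero_zero β h₁ h₂ E) (mixedTrace_zero_one β h₂ E) with h | h
      exacts [⟨0, h⟩, ⟨1, h⟩]
    obtain ⟨C, hC⟩ := (horb E).bounded_of_not_escaped he hm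
    constructor
    · obtain ⟨C', hC'⟩ := ((Finset.range (m + 1)).image fun n => |traceSeq β l₁ l₂ E n|).bddAbove
      refine ⟨max C C', fun n => ?_⟩
      rcases lt_or_ge n (m + 1) with hn | hn
      · refine le_max_of_le_right (hC' ?_)
        exact Finset.mem_coe.mpr (Finset.mem_image_of_mem _ (Finset.mem_range.mpr hn))
      · rw [← blockTrace_eq_traceSeq hβ hirr h₂ E (by omega)]
        exact le_max_of_le_left (hC n (by omega)).1
    · intro N
      rcases (hC (N + m + 1) (by omega)).2 with h | h
      · exact ⟨N + m + 1, by omega, by rwa [← blockTrace_eq_traceSeq hβ hirr h₂ E (by omega)]⟩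
      · exact ⟨N + m + 2, by omega, by rwa [← blockTrace_eq_traceSeq hβ hirr h₂ E (by omega)]⟩

end

/-! ## Spectral criteria for self-adjoint operators -/

section

open scoped InnerProductSpace

theorem hasSum_norm_sq (ψ : EllTwo) : HasSum (fun n => ‖ψ n‖ ^ 2) (‖ψ‖ ^ 2) := by
  simpa using lp.hasSum_norm (p := 2) (by norm_num) ψ

theorem inner_weightedShift {c c' : ℤ → ℝ} (hc : ∃ C, ∀ n, |c n| ≤ C) (hc' : ∃ C, ∀ n, |c' n| ≤ C)
    {k k' : ℤ} (hk : k' = -k) (h : ∀ n, c' (n + k) = c n) (φ ψ : EllTwo) :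
    ⟪weightedShift c hc k φ, ψ⟫_ℂ = ⟪φ, weightedShift c' hc' k' ψ⟫_ℂ := by
  rw [lp.inner_eq_tsum, lp.inner_eq_tsum, 
    ← (Equiv.addRight k).tsum_eq fun n => ⟪φ n, weightedShift c' hc' k' ψ n⟫_ℂ]
  refine tsum_congr fun n => ?_
  simp only [weightedShift_apply, Equiv.coe_addRight, h, hk, add_neg_cancel_right]
  simp only [RCLike.inner_apply, map_mul, Complex.conj_ofReal]
  ring

theorem isSelfAdjoint_jacobiOperator (a b : ℤ → ℝ) (ha : ∃ C, ∀ n, |a n| ≤ C)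
    (hb : ∃ C, ∀ n, |b n| ≤ C) : IsSelfAdjoint (jacobiOperator a b ha hb) := by
  rw [ContinuousLinearMap.isSelfAdjoint_iff_isSymmetric]
  intro φ ψ
  have ha' : ∃ C, ∀ n, |a (n - 1)| ≤ C := ha.imp fun _ h n => h (n - 1)
  have h1 := inner_weightedShift ha ha' (k := 1) (k' := -1) rfl (fun n => by simp) φ ψ
  have h2 := inner_weightedShift ha' ha (k := -1) (k' := 1) rfl (fun n => by simp [sub_eq_add_neg]) φ ψ
  have h3 := inner_weightedShift hb hb (k := 0) (k' := 0) rfl (fun n => by simp) φ ψ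
  simp only [jacobiOperator, ContinuousLinearMap.coe_coe, _root_.add_apply,
    inner_add_left, inner_add_right, h1, h2, h3]
  ring

variable {V : Type*} [NormedAddCommGroup V] [InnerProductSpace ℂ V]

/-- A self-adjoint operator that is bounded below is invertible. -/
theorem notMem_spectrum_of_bounded_below [CompleteSpace V] {T : V →L[ℂ] V} (hT : IsSelfAdjoint T) {E c : ℝ}
    (hc : 0 < c) (h : ∀ ψ, c * ‖ψ‖ ≤ ‖T ψ - (E : ℂ) • ψ‖) : (E : ℂ) ∉ spectrum ℂ T := by
  set S : V →L[ℂ] V := T - algebraMap ℂ (V →L[ℂ] V) E with hS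
  have hSa : IsSelfAdjoint S := by
    refine hT.sub ?_
    rw [IsSelfAdjoint, ← algebraMap_star_comm]
    simp
  have hSψ : ∀ ψ, S ψ = T ψ - (E : ℂ) • ψ := fun ψ => rfl
  have hker : ∀ ψ, S ψ = 0 → ψ = 0 := fun ψ hψ => by
    have := h ψ
    rw [← hSψ, hψ, norm_zero] at this
    exact norm_eq_zero.mp (le_antisymm (nonpos_of_mul_nonpos_right this hc) (norm_nonneg _))
  have hunit : IsUnit S := by
    rw [ContinuousLinearMap.isUnit_iff_bijective,
      ContinuousLinearMap.bijective_iff_dense_range_and_antilipschitz]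
    constructor
    · rw [Submodule.topologicalClosure_eq_top_iff, ContinuousLinearMap.orthogonal_range,
        ← ContinuousLinearMap.star_eq_adjoint, hSa.star_eq, LinearMap.ker_eq_bot']
      exact hker
    · refine ⟨Real.toNNReal c⁻¹, AddMonoidHomClass.antilipschitz_of_bound S fun ψ => ?_⟩
      rw [Real.coe_toNNReal _ (inv_pos.mpr hc).le, inv_mul_eq_div, le_div_iff₀ hc, mul_comm]
      exact h ψ
  rw [spectrum.notMem_iff, ← neg_sub]
  exact hunit.neg

theorem mem_spectrum_of_approx {T : V →L[ℂ] V} {E : ℂ}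
    (h : ∀ c : ℝ, 0 < c → ∃ ψ : V, ψ ≠ 0 ∧ ‖T ψ - E • ψ‖ ≤ c * ‖ψ‖) : E ∈ spectrum ℂ T := by
  rw [spectrum.mem_iff]
  rintro ⟨u, hu⟩
  set B : V →L[ℂ] V := ↑u⁻¹
  obtain ⟨ψ, hψ, hle⟩ := h (2 * (‖B‖ + 1))⁻¹ (by positivity)
  have h1 : B (E • ψ - T ψ) = ψ := by
    have h2 : B * (algebraMap ℂ (V →L[ℂ] V) E - T) = 1 := by rw [← hu]; exact u.inv_mul
    exact congrArg (fun R : V →L[ℂ] V => R ψ) h2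
  have h3 : ‖ψ‖ ≤ ‖B‖ * ‖T ψ - E • ψ‖ := by
    rw [norm_sub_rev]
    nth_rewrite 1 [← h1]
    exact B.le_opNorm _
  have h4 : ‖B‖ * ‖T ψ - E • ψ‖ ≤ (‖B‖ + 1) * ((2 * (‖B‖ + 1))⁻¹ * ‖ψ‖) := by gcongr; linarith
  have h5 : (‖B‖ + 1) * ((2 * (‖B‖ + 1))⁻¹ * ‖ψ‖) = ‖ψ‖ / 2 := by
    have : 0 < ‖B‖ + 1 := by positivity
    field_simp
  have h6 := norm_pos_iff.mpr hψ
  linarith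

/-- A spectral value of a self-adjoint operator on `ℓ²(ℤ)` has finitely supported approximate
eigenvectors. -/
theorem exists_finite_support_of_mem_spectrum {T : EllTwo →L[ℂ] EllTwo} (hT : IsSelfAdjoint T)
    {E c : ℝ} (hc : 0 < c) (hE : (E : ℂ) ∈ spectrum ℂ T) :
    ∃ (L : ℕ) (ψ : EllTwo), (∀ k : ℤ, (L : ℤ) < |k| → ψ k = 0) ∧
      ‖T ψ - (E : ℂ) • ψ‖ < c * ‖ψ‖ := by
  obtain ⟨φ, hφ⟩ : ∃ φ, ‖T φ - (E : ℂ) • φ‖ < c * ‖φ‖ := by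
    by_contra! h
    exact notMem_spectrum_of_bounded_below hT hc h hE
  have hsum := lp.hasSum_single (p := 2) (by norm_num) φ
  have hev : ∀ᶠ ψ in nhds φ, ‖T ψ - (E : ℂ) • ψ‖ < c * ‖ψ‖ := by
    have c1 : Continuous fun ψ : EllTwo => ‖T ψ - (E : ℂ) • ψ‖ := by fun_prop
    have c2 : Continuous fun ψ : EllTwo => c * ‖ψ‖ := by fun_prop
    exact (c1.tendsto φ).eventually_lt (c2.tendsto φ) hφ
  obtain ⟨s, hs⟩ := (hsum.eventually hev).exists
  refine ⟨∑ k ∈ s, k.natAbs, _, fun k hk => ?_, hs⟩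
  have hks : k ∉ s := fun hks => by
    have := Finset.single_le_sum (f := Int.natAbs) (fun i _ => Nat.zero_le _) hks
    rw [Int.abs_eq_natAbs] at hk
    omega
  rw [lp.coeFn_sum, Finset.sum_apply]
  refine Finset.sum_eq_zero fun i hi => ?_
  exact lp.single_apply_ne _ _ _ (by rintro rfl; exact hks hi)

end

/-! ## Approximate eigenvectors from repeated blocks -/

section

open Matrix

theorem exists_unimodular_eigenvector {M : Matrix (Fin 2) (Fin 2) ℝ} (hdet : M.det = 1)
    (htr : |M.trace| ≤ 2) :
    ∃ (z : ℂ) (w : Fin 2 → ℂ), ‖z‖ = 1 ∧ w ≠ 0 ∧ M.map Complex.ofReal *ᵥ w = z • w := by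
  set D := M.trace with hD
  have hD2 : 0 ≤ 1 - D ^ 2 / 4 := by nlinarith [abs_le.mp htr]
  set s := Real.sqrt (1 - D ^ 2 / 4) with hs
  have hs2 : s ^ 2 = 1 - D ^ 2 / 4 := Real.sq_sqrt hD2
  set z : ℂ := ⟨D / 2, s⟩ with hz
  have hzre : z = (D / 2 : ℝ) + (s : ℝ) * Complex.I := by
    apply Complex.ext <;> simp [hz]
  have hsC : (s : ℂ) ^ 2 = 1 - (D : ℂ) ^ 2 / 4 := by exact_mod_cast hs2
  have hchar : z ^ 2 - D * z + 1 = 0 := by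
    rw [hzre]
    push_cast
    linear_combination hsC * (Complex.I ^ 2) + (1 - (D : ℂ) ^ 2 / 4) * Complex.I_sq
  have hnorm : ‖z‖ = 1 := by
    rw [← sq_eq_sq₀ (norm_nonneg _) zero_le_one, ← Complex.normSq_eq_norm_sq, Complex.normSq_mk]
    nlinarith
  have hdet0 : (M.map Complex.ofReal - z • (1 : Matrix (Fin 2) (Fin 2) ℂ)).det = 0 := by
    have h1 : ((M 0 0 : ℝ) : ℂ) * M 1 1 - M 0 1 * M 1 0 = 1 := by
      rw [det_fin_two] at hdet
      exact_mod_cast hdet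
    have h2 : (D : ℂ) = M 0 0 + M 1 1 := by
      rw [hD, trace_fin_two]; push_cast; ring
    rw [det_fin_two]
    simp
    linear_combination h1 + hchar + z * h2
  obtain ⟨w, hw, hw0⟩ := exists_mulVec_eq_zero_iff.mpr hdet0
  refine ⟨z, w, hnorm, hw, ?_⟩
  rw [sub_mulVec, smul_mulVec, one_mulVec] at hw0
  exact sub_eq_zero.mp hw0

/-- The solution of the eigenvalue equation with initial data `w`, at the positions `1, 2, …`. -/
def formalSolution (a : ℤ → ℝ) (E : ℝ) (w : Fin 2 → ℂ) (j : ℕ) : ℂ :=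
  ((transferProduct a E j).map Complex.ofReal *ᵥ w) 0

variable {a : ℤ → ℝ}

theorem transferProduct_mulVec_succ (a : ℤ → ℝ) (E : ℝ) (w : Fin 2 → ℂ) (j : ℕ) :
    ((transferProduct a E (j + 1)).map Complex.ofReal *ᵥ w) 0
      = (a (j + 1) : ℂ)⁻¹ * (E * ((transferProduct a E j).map Complex.ofReal *ᵥ w) 0
        - ((transferProduct a E j).map Complex.ofReal *ᵥ w) 1) ∧
    ((transferProduct a E (j + 1)).map Complex.ofReal *ᵥ w) 1
      = (a (j + 1) : ℂ)⁻¹ * ((a (j + 1) : ℂ) ^ 2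
        * ((transferProduct a E j).map Complex.ofReal *ᵥ w) 0) := by
  have h : (transferProduct a E (j + 1)).map Complex.ofReal
      = (stepMatrix (a (j + 1)) E).map Complex.ofReal * (transferProduct a E j).map Complex.ofReal := by
    rw [transferProduct]
    exact Matrix.map_mul (f := Complex.ofRealHom)
  rw [h, ← mulVec_mulVec]
  set v := (transferProduct a E j).map Complex.ofReal *ᵥ w
  constructor <;> simp [mulVec, dotProduct, Fin.sum_univ_two, stepMatrix] <;> ring

theorem formalSolution_add_two (ha : ∀ k, a k ≠ 0) (E : ℝ) (w : Fin 2 → ℂ) (j : ℕ) :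
    (a (j + 2) : ℂ) * formalSolution a E w (j + 2) + a (j + 1) * formalSolution a E w j
      = E * formalSolution a E w (j + 1) := by
  have h1 := (transferProduct_mulVec_succ a E w (j + 1)).1
  have h2 := (transferProduct_mulVec_succ a E w j).2
  have ha1 : (a (j + 1) : ℂ) ≠ 0 := by exact_mod_cast ha _
  have ha2 : (a (j + 2) : ℂ) ≠ 0 := by exact_mod_cast ha _
  have e : ((j + 1 : ℕ) : ℤ) + 1 = j + 2 := by push_cast; ring
  rw [e, h2] at h1
  simp only [formalSolution]
  rw [h1]
  field_simp
  ring

theorem formalSolution_zero (E : ℝ) (w : Fin 2 → ℂ) : formalSolution a E w 0 = w 0 := by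
  simp [formalSolution, transferProduct]

theorem eq_zero_of_formalSolution (ha : ∀ k, a k ≠ 0) {E : ℝ} {w : Fin 2 → ℂ}
    (h0 : formalSolution a E w 0 = 0) (h1 : formalSolution a E w 1 = 0) : w = 0 := by
  have h := (transferProduct_mulVec_succ a E w 0).1
  change formalSolution a E w 1 = _ at h
  rw [h1] at h
  rw [formalSolution_zero] at h0
  have ha1 : (a (0 + 1) : ℂ) ≠ 0 := by exact_mod_cast ha _
  simp [transferProduct, h0] at h
  have h2 : w 1 = 0 := h.resolve_left (by simpa using ha1)
  ext i
  fin_cases i <;> simp [h0, h2]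

theorem formalSolution_add {E : ℝ} {q : ℕ} {z : ℂ} {w : Fin 2 → ℂ}
    (hw : (transferProduct a E q).map Complex.ofReal *ᵥ w = z • w) {j : ℕ}
    (hper : ∀ k : ℤ, 1 ≤ k → k ≤ j → a (k + q) = a k) :
    formalSolution a E w (j + q) = z * formalSolution a E w j := by
  have h : (transferProduct a E (j + q)).map Complex.ofReal
      = (transferProduct a E j).map Complex.ofReal * (transferProduct a E q).map Complex.ofReal := by
    rw [transferProduct_add, transferProduct_congr (b := a) E hper]
    exact Matrix.map_mul (f := Complex.ofRealHom)
  rw [formalSolution, h, ← mulVec_mulVec, hw, mulVec_smul]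
  rfl

/-- The tent function centred at `q + 1`. -/
def tent (q : ℕ) (k : ℤ) : ℝ := max 0 ((q : ℝ) - 1 - |(k : ℝ) - (q + 1)|)

theorem tent_eq_zero {q : ℕ} {k : ℤ} (hk : k ≤ 2 ∨ 2 * q ≤ k) : tent q k = 0 := by
  refine max_eq_left ?_
  rcases hk with hk | hk
  · have : (k : ℝ) ≤ 2 := by exact_mod_cast hk
    linarith [neg_abs_le ((k : ℝ) - (q + 1))]
  · have : 2 * (q : ℝ) ≤ k := by exact_mod_cast hk
    linarith [le_abs_self ((k : ℝ) - (q + 1))]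

theorem abs_tent_sub_le (q : ℕ) (k : ℤ) : |tent q (k + 1) - tent q k| ≤ 1 := by
  have h1 : |(k : ℝ) - (q + 1)| - 1 ≤ |((k + 1 : ℤ) : ℝ) - (q + 1)| := by
    have := abs_sub_abs_le_abs_sub ((k : ℝ) - (q + 1)) (((k + 1 : ℤ) : ℝ) - (q + 1))
    rw [show (k : ℝ) - (q + 1) - (((k + 1 : ℤ) : ℝ) - (q + 1)) = -1 by push_cast; ring, abs_neg,
      abs_one] at this
    linarith
  have h2 : |((k + 1 : ℤ) : ℝ) - (q + 1)| ≤ |(k : ℝ) - (q + 1)| + 1 := by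
    have := abs_add_le ((k : ℝ) - (q + 1)) 1
    rw [abs_one] at this
    push_cast
    rwa [show (k : ℝ) + 1 - (q + 1) = k - (q + 1) + 1 by ring]
  rw [tent, tent, abs_le]
  constructor
  · rcases max_cases 0 ((q : ℝ) - 1 - |(k : ℝ) - (q + 1)|) with h | h <;>
      rcases max_cases 0 ((q : ℝ) - 1 - |((k + 1 : ℤ) : ℝ) - (q + 1)|) with h' | h' <;> linarith
  · rcases max_cases 0 ((q : ℝ) - 1 - |(k : ℝ) - (q + 1)|) with h | h <;>
      rcases max_cases 0 ((q : ℝ) - 1 - |((k + 1 : ℤ) : ℝ) - (q + 1)|) with h' | h' <;> linarith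

theorem tent_sq_add_le {q j : ℕ} (hq : 2 ≤ q) (hj : j < q) :
    ((q : ℝ) - 2) ^ 2 / 2 ≤ tent q (j + 1) ^ 2 + tent q (j + 1 + q) ^ 2 := by
  have hjq : (j : ℝ) + 1 ≤ q := by exact_mod_cast hj
  have hq' : (2 : ℝ) ≤ q := by exact_mod_cast hq
  have hj0 : (0 : ℝ) ≤ j := Nat.cast_nonneg j
  have h1 : (j : ℝ) - 1 ≤ tent q (j + 1) := by
    refine le_trans (le_of_eq ?_) (le_max_right _ _)
    push_cast
    rw [abs_of_nonpos (by linarith)]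
    ring
  have h2 : (q : ℝ) - 1 - j ≤ tent q (j + 1 + q) := by
    refine le_trans (le_of_eq ?_) (le_max_right _ _)
    push_cast
    rw [abs_of_nonneg (by linarith)]
    ring
  nlinarith [sq_nonneg (tent q (j + 1) - tent q (j + 1 + q))]

theorem hasSum_int_of_support {f : ℤ → ℝ} {N : ℕ} (hf : ∀ k : ℤ, k ≤ 0 ∨ (N : ℤ) < k → f k = 0) :
    HasSum f (∑ j ∈ Finset.range N, f (j + 1)) := by
  have hinj : Function.Injective fun j : ℕ => (j : ℤ) + 1 := fun i j h => by simpa using h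
  rw [← hinj.hasSum_iff]
  · refine hasSum_sum_of_ne_finset_zero (f := f ∘ fun j : ℕ => (j : ℤ) + 1) fun j hj => ?_
    rw [Finset.mem_range] at hj
    exact hf ((j : ℤ) + 1) (Or.inr (by omega))
  · intro k hk
    refine hf k (Or.inl ?_)
    by_contra! h
    exact hk ⟨(k - 1).toNat, by simp only; omega⟩

theorem norm_sq_le_of_neighbor_bound {φ : EllTwo} {G : ℤ → ℝ} {C S : ℝ}
    (hφ : ∀ k, ‖φ k‖ ≤ C * (G (k + 1) + G (k - 1))) (hG : HasSum (fun k => G k ^ 2) S) :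
    ‖φ‖ ^ 2 ≤ 4 * C ^ 2 * S := by
  have g1 : HasSum ((fun k => G k ^ 2) ∘ Equiv.addRight (1 : ℤ)) S :=
    (Equiv.hasSum_iff _).mpr hG
  have g2 : HasSum ((fun k => G k ^ 2) ∘ Equiv.subRight (1 : ℤ)) S :=
    (Equiv.hasSum_iff _).mpr hG
  have hle : ∀ k, ‖φ k‖ ^ 2 ≤ 2 * C ^ 2 * (G (k + 1) ^ 2 + G (k - 1) ^ 2) := fun k => by
    have h1 := pow_le_pow_left₀ (norm_nonneg _) (hφ k) 2
    nlinarith [mul_nonneg (sq_nonneg C) (sq_nonneg (G (k + 1) - G (k - 1)))]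
  have h := hasSum_le hle (hasSum_norm_sq φ) ((g1.add g2).mul_left (2 * C ^ 2))
  linarith

theorem exists_approx_eigenvector {C : ℝ} (ha : ∀ k, a k ≠ 0) (hC : ∀ k, |a k| ≤ C)
    (ha' : ∃ C, ∀ k, |a k| ≤ C) (hb : ∃ C, ∀ _ : ℤ, |(0 : ℝ)| ≤ C) (E : ℝ) {q : ℕ} (hq : 3 ≤ q)
    (hper : ∀ k : ℤ, 1 ≤ k → k < q → a (k + q) = a k)
    (htr : |(transferProduct a E q).trace| ≤ 2) :
    ∃ ψ : EllTwo, ψ ≠ 0 ∧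
      ‖jacobiOperator a (fun _ => 0) ha' hb ψ - (E : ℂ) • ψ‖ ≤ 4 * C / (q - 2) * ‖ψ‖ := by
  obtain ⟨z, w, hz, hw, hMw⟩ := exists_unimodular_eigenvector (det_transferProduct ha E q) htr
  set U := formalSolution a E w with hU
  have hUper : ∀ j < q, ‖U (q + j)‖ = ‖U j‖ := fun j hj => by
    rw [add_comm, hU, formalSolution_add hMw fun k h1 h2 => hper k h1 (by omega), norm_mul, hz, one_mul]
  set P := ∑ j ∈ Finset.range q, ‖U j‖ ^ 2 with hP
  have hPpos : 0 < P := by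
    by_contra! hP0
    have hall : ∀ j < q, U j = 0 := fun j hj => by
      have h1 := Finset.single_le_sum (f := fun j => ‖U j‖ ^ 2) (fun i _ => sq_nonneg _)
        (Finset.mem_range.mpr hj)
      have h2 : ‖U j‖ ^ 2 ≤ 0 := h1.trans hP0
      exact norm_eq_zero.mp (pow_eq_zero_iff two_ne_zero |>.mp (le_antisymm h2 (sq_nonneg _)))
    exact hw (eq_zero_of_formalSolution ha (hall 0 (by omega)) (hall 1 (by omega)))
  set u : ℤ → ℂ := fun k => U (k - 1).toNat with hu
  have hu1 : ∀ j : ℕ, u (j + 1) = U j := fun j => by simp [hu]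
  have hsol : ∀ k : ℤ, 2 ≤ k →
      (a k : ℂ) * u (k + 1) + a (k - 1) * u (k - 1) = E * u k := by
    intro k hk
    obtain ⟨j, rfl⟩ : ∃ j : ℕ, k = j + 2 := ⟨(k - 2).toNat, by omega⟩
    have h := formalSolution_add_two ha E w j
    have e1 : ((j : ℤ) + 2 + 1) = ((j + 2 : ℕ) : ℤ) + 1 := by push_cast; ring
    have e2 : ((j : ℤ) + 2 - 1) = (j : ℤ) + 1 := by ring
    have e3 : ((j : ℤ) + 2) = ((j + 1 : ℕ) : ℤ) + 1 := by push_cast; ring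
    have h3 : u ((j : ℤ) + 2) = U (j + 1) := by rw [e3, hu1]
    rw [e1, e2, hu1, hu1, h3]
    exact h
  have hsum : ∀ f : ℕ → ℝ, ∑ j ∈ Finset.range (2 * q), f j * ‖U j‖ ^ 2
      = ∑ j ∈ Finset.range q, (f j + f (q + j)) * ‖U j‖ ^ 2 := by
    intro f
    rw [two_mul, Finset.sum_range_add, ← Finset.sum_add_distrib]
    refine Finset.sum_congr rfl fun j hj => ?_
    rw [hUper j (Finset.mem_range.mp hj)]
    ring
  set ψ : EllTwo := ∑ k ∈ Finset.Icc (1 : ℤ) (2 * q), lp.single 2 k ((tent q k : ℂ) * u k) with hψ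
  have hψk : ∀ k, ψ k = (tent q k : ℂ) * u k := by
    intro k
    rw [hψ, lp.coeFn_sum, Finset.sum_apply]
    by_cases hk : k ∈ Finset.Icc (1 : ℤ) (2 * q)
    · rw [Finset.sum_eq_single_of_mem k hk fun i _ hi => lp.single_apply_ne _ _ _ hi.symm]
      exact lp.single_apply_self _ _ _
    · rw [Finset.sum_eq_zero fun i hi => lp.single_apply_ne _ _ _ (by rintro rfl; exact hk hi)]
      rw [Finset.mem_Icc, not_and_or] at hk
      rw [tent_eq_zero (by omega)]
      simp
  have hq3 : (3 : ℝ) ≤ q := by exact_mod_cast hq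
  have hlow : ((q : ℝ) - 2) ^ 2 / 2 * P ≤ ‖ψ‖ ^ 2 := by
    have h1 := hasSum_norm_sq ψ
    have h2 : HasSum (fun k => ‖ψ k‖ ^ 2) _ := hasSum_int_of_support (N := 2 * q) fun k hk => by
      rw [hψk, tent_eq_zero (by push_cast at hk; omega)]
      simp
    rw [h1.unique h2]
    have h3 : ∀ j : ℕ, ‖ψ (j + 1)‖ ^ 2 = tent q (j + 1) ^ 2 * ‖U j‖ ^ 2 := fun j => by
      rw [hψk, hu1, norm_mul, Complex.norm_real, mul_pow, Real.norm_eq_abs, sq_abs]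
    simp only [h3]
    rw [hsum fun j => tent q (j + 1) ^ 2, hP, Finset.mul_sum]
    refine Finset.sum_le_sum fun j hj => mul_le_mul_of_nonneg_right ?_ (sq_nonneg _)
    have h4 := tent_sq_add_le (by omega) (Finset.mem_range.mp hj)
    have h5 : ((q + j : ℕ) : ℤ) + 1 = j + 1 + q := by push_cast; ring
    simpa only [h5] using h4
  set G : ℤ → ℝ := fun k => if 1 ≤ k ∧ k ≤ 2 * q then ‖u k‖ else 0 with hG
  have hGsum : HasSum (fun k => G k ^ 2) (2 * P) := by
    have h1 : HasSum (fun k => G k ^ 2) _ := hasSum_int_of_support (N := 2 * q) fun k hk => by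
      rw [hG]
      simp only
      rw [if_neg (by push_cast at hk; omega)]
      simp
    convert h1 using 1
    have h2 := hsum fun _ => 1
    simp only [one_mul] at h2
    rw [hP, Finset.mul_sum, ← one_add_one_eq_two, ← h2]
    refine Finset.sum_congr rfl fun j hj => ?_
    rw [Finset.mem_range] at hj
    rw [hG]
    simp only
    rw [if_pos (by omega), hu1]
  have hC0 : 0 ≤ C := (abs_nonneg _).trans (hC 0)
  set φ := jacobiOperator a (fun _ => 0) ha' hb ψ - (E : ℂ) • ψ with hφ
  have hφk : ∀ k, ‖φ k‖ ≤ C * (G (k + 1) + G (k - 1)) := by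
    intro k
    have hG0 : ∀ k, 0 ≤ G k := fun k => by rw [hG]; simp only; split_ifs <;> positivity
    have h1 : φ k = (a k : ℂ) * ψ (k + 1) + a (k - 1) * ψ (k - 1) - E * ψ k := by
      have h2 : φ k = jacobiOperator a (fun _ => 0) ha' hb ψ k - E * ψ k := rfl
      rw [h2, jacobiOperator_apply]
      simp
    rw [hψk, hψk, hψk] at h1
    rcases le_or_gt k 1 with hk | hk
    · rw [tent_eq_zero (k := k + 1) (by omega), tent_eq_zero (k := k - 1) (by omega),
        tent_eq_zero (k := k) (by omega)] at h1
      rw [h1]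
      simpa using mul_nonneg hC0 (add_nonneg (hG0 _) (hG0 _))
    · have h2 : φ k = (a k : ℂ) * (((tent q (k + 1) - tent q k : ℝ) : ℂ) * u (k + 1))
          + a (k - 1) * (((tent q (k - 1) - tent q k : ℝ) : ℂ) * u (k - 1)) := by
        rw [h1]
        push_cast
        linear_combination (tent q k : ℂ) * hsol k (by omega)
      have h3 : ‖((tent q (k + 1) - tent q k : ℝ) : ℂ) * u (k + 1)‖ ≤ G (k + 1) := by
        rw [hG]
        simp only
        split_ifs with hc
        · rw [norm_mul, Complex.norm_real, Real.norm_eq_abs]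
          exact mul_le_of_le_one_left (norm_nonneg _) (abs_tent_sub_le q k)
        · rw [tent_eq_zero (k := k + 1) (by omega), tent_eq_zero (k := k) (by omega)]
          simp
      have h4 : ‖((tent q (k - 1) - tent q k : ℝ) : ℂ) * u (k - 1)‖ ≤ G (k - 1) := by
        rw [hG]
        simp only
        split_ifs with hc
        · rw [norm_mul, Complex.norm_real, Real.norm_eq_abs]
          refine mul_le_of_le_one_left (norm_nonneg _) ?_
          have := abs_tent_sub_le q (k - 1)
          rwa [sub_add_cancel, abs_sub_comm] at this
        · rw [tent_eq_zero (k := k - 1) (by omega), tent_eq_zero (k := k) (by omega)]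
          simp
      rw [h2, mul_add]
      refine (norm_add_le _ _).trans (add_le_add ?_ ?_)
      · rw [norm_mul, Complex.norm_real, Real.norm_eq_abs]
        exact mul_le_mul (hC _) h3 (norm_nonneg _) hC0
      · rw [norm_mul, Complex.norm_real, Real.norm_eq_abs]
        exact mul_le_mul (hC _) h4 (norm_nonneg _) hC0
  have hup : ‖φ‖ ^ 2 ≤ 8 * C ^ 2 * P := by
    have h := norm_sq_le_of_neighbor_bound hφk hGsum
    linarith
  refine ⟨ψ, ?_, ?_⟩
  · intro h0
    rw [h0, norm_zero] at hlow
    have : 0 < ((q : ℝ) - 2) ^ 2 / 2 * P := by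
      have : 0 < (q : ℝ) - 2 := by linarith
      positivity
    linarith
  · have hq2 : 0 < (q : ℝ) - 2 := by linarith
    generalize (q : ℝ) - 2 = d at hq2 hlow
    have hnn : 0 ≤ 4 * C / d * ‖ψ‖ := by positivity
    refine (sq_le_sq₀ (norm_nonneg φ) hnn).mp ?_
    rw [mul_pow, div_pow]
    have h1 : 8 * C ^ 2 * P = (4 * C) ^ 2 / d ^ 2 * (d ^ 2 / 2 * P) := by field_simp; ring
    rw [h1] at hup
    exact hup.trans (mul_le_mul_of_nonneg_left hlow (by positivity))

end

/-! ## Cyclic approximants -/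

section

open Matrix
open scoped InnerProductSpace

/-- A symmetric operator on a finite-dimensional space has an eigenvalue near each approximate one. -/
theorem exists_eigenvector_of_approx {V : Type*} [NormedAddCommGroup V] [InnerProductSpace ℂ V]
    [FiniteDimensional ℂ V] {T : V →ₗ[ℂ] V} (hT : T.IsSymmetric) {E c : ℝ} {ψ : V}
    (hψ : ‖T ψ - (E : ℂ) • ψ‖ < c * ‖ψ‖) :
    ∃ μ : ℝ, |μ - E| < c ∧ ∃ v : V, v ≠ 0 ∧ T v = (μ : ℂ) • v := by
  set e := hT.eigenvectorBasis rfl with he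
  set μ := hT.eigenvalues rfl with hμ
  by_contra! hcon
  have hfar : ∀ i, c ≤ |μ i - E| := fun i => by
    by_contra! hi
    exact hcon (μ i) hi (e i) (e.orthonormal.ne_zero i) (hT.apply_eigenvectorBasis rfl i)
  have hc : 0 < c := by
    by_contra! h
    exact (hψ.trans_le (mul_nonpos_of_nonpos_of_nonneg h (norm_nonneg ψ))).not_ge (norm_nonneg _)
  have hcoord : ∀ i, ‖e.repr (T ψ - (E : ℂ) • ψ) i‖ = |μ i - E| * ‖e.repr ψ i‖ := fun i => by
    have h1 : e.repr (T ψ - (E : ℂ) • ψ) i = ((μ i - E : ℝ) : ℂ) * e.repr ψ i := by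
      rw [map_sub, map_smul, PiLp.sub_apply, PiLp.smul_apply,
        hT.eigenvectorBasis_apply_self_apply rfl ψ i, smul_eq_mul]
      push_cast
      rw [sub_mul]
      rfl
    rw [h1, norm_mul, Complex.norm_real, Real.norm_eq_abs]
  have hle : (c * ‖ψ‖) ^ 2 ≤ ‖T ψ - (E : ℂ) • ψ‖ ^ 2 := by
    rw [← e.repr.norm_map ψ, ← e.repr.norm_map (T ψ - (E : ℂ) • ψ), mul_pow,
      EuclideanSpace.norm_sq_eq, EuclideanSpace.norm_sq_eq, Finset.mul_sum]
    refine Finset.sum_le_sum fun i _ => ?_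
    rw [hcoord, mul_pow]
    gcongr
    exact hfar i
  exact hψ.not_ge ((sq_le_sq₀ (by positivity) (norm_nonneg _)).mp hle)

variable {q : ℕ}

/-- The Jacobi operator with off-diagonal entries `b` and periodic boundary conditions. -/
def cyclicJacobi (b : ZMod q → ℝ) : EuclideanSpace ℂ (ZMod q) →ₗ[ℂ] EuclideanSpace ℂ (ZMod q) where
  toFun ψ := WithLp.toLp 2 fun z => (b z : ℂ) * ψ (z + 1) + b (z - 1) * ψ (z - 1)
  map_add' φ ψ := by
    ext z
    simp only [PiLp.add_apply]
    ring
  map_smul' r ψ := by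
    ext z
    simp only [PiLp.smul_apply, smul_eq_mul, RingHom.id_apply]
    ring

theorem cyclicJacobi_apply (b : ZMod q → ℝ) (ψ : EuclideanSpace ℂ (ZMod q)) (z : ZMod q) :
    cyclicJacobi b ψ z = (b z : ℂ) * ψ (z + 1) + b (z - 1) * ψ (z - 1) := rfl

variable [NeZero q]

theorem cyclicJacobi_isSymmetric (b : ZMod q → ℝ) : (cyclicJacobi b).IsSymmetric := by
  intro φ ψ
  have h1 := Equiv.sum_comp (Equiv.addRight (1 : ZMod q))
    fun z => (b (z - 1) : ℂ) * ψ (z - 1) * (starRingEnd ℂ) (φ z)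
  have h2 := Equiv.sum_comp (Equiv.addRight (1 : ZMod q))
    fun z => (b (z - 1) : ℂ) * ψ z * (starRingEnd ℂ) (φ (z - 1))
  simp only [Equiv.coe_addRight, add_sub_cancel_right] at h1 h2
  simp only [PiLp.inner_apply, cyclicJacobi_apply, RCLike.inner_apply, map_add, map_mul,
    Complex.conj_ofReal, add_mul, mul_add, Finset.sum_add_distrib]
  rw [add_comm]
  refine congrArg₂ (· + ·) ?_ ?_
  · refine Eq.trans (Finset.sum_congr rfl fun z _ => ?_) h2.symm
    ring
  · refine Eq.trans (Finset.sum_congr rfl fun z _ => ?_) h1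
    ring

theorem trace_eq_two_of_cyclic_eigenvector {b : ZMod q → ℝ} (hb : ∀ z, b z ≠ 0) {E : ℝ}
    {v : EuclideanSpace ℂ (ZMod q)} (hv : v ≠ 0) (hE : cyclicJacobi b v = (E : ℂ) • v) :
    (transferProduct (fun k : ℤ => b k) E q).trace = 2 := by
  set a : ℤ → ℝ := fun k => b k with ha
  have ha0 : ∀ k, a k ≠ 0 := fun k => hb k
  set w : Fin 2 → ℂ := ![v 1, b 0 * v 0] with hw
  have hsol : ∀ z : ZMod q, (b z : ℂ) * v (z + 1) + b (z - 1) * v (z - 1) = E * v z := fun z => by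
    rw [← cyclicJacobi_apply, hE]
    rfl
  have hV : ∀ k : ℕ, ((transferProduct a E k).map Complex.ofReal *ᵥ w) 0 = v ((k : ZMod q) + 1) ∧
      ((transferProduct a E k).map Complex.ofReal *ᵥ w) 1 = b k * v (k : ZMod q) := by
    intro k
    induction k with
    | zero => simp [transferProduct, hw]
    | succ k ih =>
      have h := transferProduct_mulVec_succ a E w k
      have hak : a ((k : ℤ) + 1) = b ((k : ZMod q) + 1) := by simp [ha]
      have hne : (b ((k : ZMod q) + 1) : ℂ) ≠ 0 := by exact_mod_cast hb _
      have hs := hsol ((k : ZMod q) + 1)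
      rw [add_sub_cancel_right] at hs
      rw [ih.1, ih.2, hak] at h
      push_cast
      constructor
      · rw [h.1, ← hs]
        field_simp
        ring
      · rw [h.2]
        field_simp
  have hfix : (transferProduct a E q).map Complex.ofReal *ᵥ w = w := by
    have h := hV q
    simp only [ZMod.natCast_self, zero_add] at h
    ext i
    fin_cases i
    · exact h.1
    · exact h.2
  have hw0 : w ≠ 0 := by
    intro h0
    refine hv ?_
    ext z
    have h := (hV (z - 1).val).1
    rw [h0, mulVec_zero, ZMod.natCast_zmod_val, sub_add_cancel] at h
    exact h.symm
  have hdet0 : ((transferProduct a E q).map Complex.ofReal - 1).det = 0 := by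
    refine exists_mulVec_eq_zero_iff.mp ⟨w, hw0, ?_⟩
    rw [sub_mulVec, hfix, one_mulVec, sub_self]
  have hdet := det_transferProduct ha0 E q
  set M := transferProduct a E q
  have h1 : ((M 0 0 : ℝ) : ℂ) * M 1 1 - M 0 1 * M 1 0 = 1 := by
    rw [det_fin_two] at hdet
    exact_mod_cast hdet
  have h2 : ((M 0 0 + M 1 1 : ℝ) : ℂ) = (2 : ℝ) := by
    rw [det_fin_two] at hdet0
    simp at hdet0
    push_cast
    linear_combination h1 - hdet0
  rw [trace_fin_two]
  exact_mod_cast h2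

theorem norm_sq_eq_sum_valMinAbs {φ : EllTwo} {L : ℕ} (hφ : ∀ k : ℤ, (L : ℤ) < |k| → φ k = 0)
    (hL : 2 * L < q) : ‖φ‖ ^ 2 = ∑ z : ZMod q, ‖φ z.valMinAbs‖ ^ 2 := by
  refine (hasSum_norm_sq φ).unique ?_
  rw [← (ZMod.injective_valMinAbs (n := q)).hasSum_iff]
  · exact hasSum_fintype _
  · intro k hk
    rw [hφ k ?_]
    · simp
    by_contra! h
    rw [abs_le] at h
    refine hk ⟨(k : ZMod q), (ZMod.valMinAbs_spec _ _).mpr ⟨rfl, ?_⟩⟩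
    constructor <;> omega

theorem valMinAbs_intCast_cases {j : ℤ} :
    ∃ m : ℤ, (j : ZMod q).valMinAbs = j + m * q ∧ -(q : ℤ) < (j + m * q) * 2 ∧ (j + m * q) * 2 ≤ q := by
  have h1 : (((j : ZMod q).valMinAbs : ℤ) : ZMod q) = (j : ZMod q) := ZMod.coe_valMinAbs _
  obtain ⟨m, hm⟩ := (ZMod.intCast_eq_intCast_iff_dvd_sub j _ q).mp h1.symm
  have h2 := ZMod.valMinAbs_mem_Ioc (j : ZMod q)
  refine ⟨m, by linarith, ?_, ?_⟩
  · have := h2.1; linarith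
  · have := h2.2; linarith

theorem apply_valMinAbs_intCast {φ : EllTwo} {L : ℕ} (hφ : ∀ k : ℤ, (L : ℤ) < |k| → φ k = 0)
    (hL : 2 * L < q) {j : ℤ} (hj : |j| + L < q) : φ (j : ZMod q).valMinAbs = φ j := by
  obtain ⟨m, hm, h1, h2⟩ := valMinAbs_intCast_cases (q := q) (j := j)
  rw [hm]
  rcases lt_trichotomy m 0 with h0 | h0 | h0
  · have : m * q ≤ -q := by nlinarith
    rw [hφ (j + m * q) (by rw [lt_abs]; rw [← lt_sub_iff_add_lt, abs_lt] at hj; omega),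
      hφ j (by rw [lt_abs]; omega)]
  · rw [h0, zero_mul, add_zero]
  · have : (q : ℤ) ≤ m * q := by nlinarith
    rw [hφ (j + m * q) (by rw [lt_abs]; rw [← lt_sub_iff_add_lt, abs_lt] at hj; omega),
      hφ j (by rw [lt_abs]; omega)]

theorem apply_valMinAbs_of_periodic {a : ℤ → ℝ} (hper : ∀ k : ℤ, -(q : ℤ) < k → k ≤ 0 → a (k + q) = a k)
    {j : ℤ} (hj : -(q : ℤ) < j) (hj' : j ≤ q) : a (j : ZMod q).valMinAbs = a j := by
  obtain ⟨m, hm, h1, h2⟩ := valMinAbs_intCast_cases (q := q) (j := j)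
  rw [hm]
  have hm1 : m ≤ 1 := by nlinarith
  have hm2 : -1 ≤ m := by nlinarith
  obtain rfl | rfl | rfl : m = -1 ∨ m = 0 ∨ m = 1 := by omega
  · rw [← hper (j + -1 * q) (by linarith) (by linarith)]
    congr 1
    ring
  · rw [zero_mul, add_zero]
  · rw [one_mul] at *
    exact hper j hj (by linarith)

/-- A finitely supported approximate eigenvector living on a window where the off-diagonal sequence
is `q`-periodic yields a nearby energy at which the transfer matrix over one period has trace `2`. -/
theorem exists_trace_eq_two {a : ℤ → ℝ} (ha : ∀ k, a k ≠ 0)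
    (ha' : ∃ C, ∀ k, |a k| ≤ C) (hb : ∃ C, ∀ _ : ℤ, |(0 : ℝ)| ≤ C)
    (hper : ∀ k : ℤ, -(q : ℤ) < k → k ≤ 0 → a (k + q) = a k) {L : ℕ} (hL : 2 * L + 4 ≤ q)
    {ψ : EllTwo} (hψ : ∀ k : ℤ, (L : ℤ) < |k| → ψ k = 0) {E c : ℝ}
    (hE : ‖jacobiOperator a (fun _ => 0) ha' hb ψ - (E : ℂ) • ψ‖ < c * ‖ψ‖) :
    ∃ E' : ℝ, |E' - E| < c ∧ (transferProduct a E' q).trace = 2 := by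
  set b : ZMod q → ℝ := fun z => a z.valMinAbs with hbdef
  set ψ' : EuclideanSpace ℂ (ZMod q) := WithLp.toLp 2 fun z => ψ z.valMinAbs with hψ'
  set φ := jacobiOperator a (fun _ => 0) ha' hb ψ - (E : ℂ) • ψ with hφ
  have hφk : ∀ k, φ k = (a k : ℂ) * ψ (k + 1) + a (k - 1) * ψ (k - 1) - E * ψ k := fun k => by
    have h2 : φ k = jacobiOperator a (fun _ => 0) ha' hb ψ k - E * ψ k := rfl
    rw [h2, jacobiOperator_apply]
    simp
  have hφ0 : ∀ k : ℤ, ((L + 1 : ℕ) : ℤ) < |k| → φ k = 0 := fun k hk => by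
    rw [lt_abs] at hk
    push_cast at hk
    rw [hφk, hψ k (by rw [lt_abs]; omega), hψ (k + 1) (by rw [lt_abs]; omega),
      hψ (k - 1) (by rw [lt_abs]; omega)]
    simp
  have hcyc : ∀ z : ZMod q, (cyclicJacobi b ψ' - (E : ℂ) • ψ') z = φ z.valMinAbs := by
    intro z
    set k := z.valMinAbs with hk
    have hzk : z = ((k : ℤ) : ZMod q) := (ZMod.coe_valMinAbs z).symm
    have hkq : -(q : ℤ) < k * 2 ∧ k * 2 ≤ q := ZMod.valMinAbs_mem_Ioc z
    have e1 : ψ' (z + 1) = ψ (k + 1) := by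
      have := apply_valMinAbs_intCast (q := q) hψ (by omega) (j := k + 1)
        (by rw [← lt_sub_iff_add_lt, abs_lt]; omega)
      rw [← this, hψ', hzk]
      push_cast
      rfl
    have e2 : ψ' (z - 1) = ψ (k - 1) := by
      have := apply_valMinAbs_intCast (q := q) hψ (by omega) (j := k - 1)
        (by rw [← lt_sub_iff_add_lt, abs_lt]; omega)
      rw [← this, hψ', hzk]
      push_cast
      rfl
    have e3 : b (z - 1) = a (k - 1) := by
      have := apply_valMinAbs_of_periodic (q := q) hper (j := k - 1) (by omega) (by omega)
      rw [← this, hbdef, hzk]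
      push_cast
      rfl
    rw [PiLp.sub_apply, PiLp.smul_apply, cyclicJacobi_apply, e1, e2, e3, hφk]
    rfl
  have hn1 : ‖ψ'‖ = ‖ψ‖ := by
    rw [← sq_eq_sq₀ (norm_nonneg _) (norm_nonneg _), EuclideanSpace.norm_sq_eq,
      norm_sq_eq_sum_valMinAbs (q := q) hψ (by omega)]
  have hn2 : ‖cyclicJacobi b ψ' - (E : ℂ) • ψ'‖ = ‖φ‖ := by
    rw [← sq_eq_sq₀ (norm_nonneg _) (norm_nonneg _), EuclideanSpace.norm_sq_eq,
      norm_sq_eq_sum_valMinAbs (q := q) hφ0 (by omega)]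
    exact Finset.sum_congr rfl fun z _ => by rw [hcyc]
  rw [← hn1, ← hn2] at hE
  obtain ⟨μ, hμ, v, hv, hev⟩ := exists_eigenvector_of_approx (cyclicJacobi_isSymmetric b) hE
  refine ⟨μ, hμ, ?_⟩
  rw [← trace_eq_two_of_cyclic_eigenvector (fun z => ha _) hv hev]
  congr 1
  refine transferProduct_congr μ fun k h1 h2 => ?_
  exact (apply_valMinAbs_of_periodic hper (by omega) h2).symm

end

/-! ## The spectrum and the pseudo-spectrum -/

section

variable {β l₁ l₂ : ℝ}

theorem mem_spectrum_of_frequently (hβ : β ∈ Set.Icc (0 : ℝ) 1) (hirr : Irrational β)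
    (h₁ : 0 < l₁) (h₂ : 0 < l₂) {E : ℝ} (h : ∀ N, ∃ n, N ≤ n ∧ |traceSeq β l₁ l₂ E n| ≤ 2) :
    (E : ℂ) ∈ spectrum ℂ (offDiagonalOperator β l₁ l₂) := by
  obtain ⟨C, hC⟩ := hopping_bounded β l₁ l₂
  have hC0 : 0 ≤ C := (abs_nonneg _).trans (hC 0)
  refine mem_spectrum_of_approx fun c hc => ?_
  obtain ⟨N, hN⟩ := exists_nat_gt (4 * C / c + 2)
  obtain ⟨n, hn, htr⟩ := h (N + 3)
  obtain ⟨m, rfl⟩ : ∃ m, n = m + 1 := ⟨n - 1, by omega⟩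
  have hq := le_convergentDen hβ hirr (m + 1)
  have hqm := convergentDen_pos hβ hirr m
  have hadd := convergentDen_add_le hβ hirr m
  obtain ⟨ψ, hψ, hle⟩ := exists_approx_eigenvector
    (fun k => (hopping_pos hβ hirr h₁ h₂ k).ne') hC (hopping_bounded β l₁ l₂)
    ⟨0, fun _ => by simp⟩ E (q := convergentDen β (m + 1)) (by omega) (fun k h1 h2 => by
      have h3 := sturmian_add_convergentDen hβ hirr (m + 1) h1
        (by change _ ≤ ((convergentDen β (m + 2) : ℕ) : ℤ); omega)
      rw [hopping, hopping, h3]) htr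
  refine ⟨ψ, hψ, hle.trans (mul_le_mul_of_nonneg_right ?_ (norm_nonneg _))⟩
  have hqN : (N : ℝ) ≤ convergentDen β (m + 1) := by
    exact_mod_cast (show N ≤ convergentDen β (m + 1) by omega)
  have h4 : 0 ≤ 4 * C / c := by positivity
  rw [div_le_iff₀ (by linarith), ← div_le_iff₀' hc]
  linarith

theorem exists_trace_le_two_near (hβ : β ∈ Set.Icc (0 : ℝ) 1) (hirr : Irrational β)
    (h₁ : 0 < l₁) (h₂ : 0 < l₂) {E : ℝ} (hE : (E : ℂ) ∈ spectrum ℂ (offDiagonalOperator β l₁ l₂))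
    {c : ℝ} (hc : 0 < c) (N : ℕ) :
    ∃ n E', N ≤ n ∧ |E' - E| < c ∧ |traceSeq β l₁ l₂ E' n| ≤ 2 := by
  obtain ⟨L, ψ, hψ, hlt⟩ := exists_finite_support_of_mem_spectrum
    (isSelfAdjoint_jacobiOperator _ _ _ _) hc hE
  obtain ⟨m, hm⟩ : ∃ m, m = N + L + 1 := ⟨_, rfl⟩
  have hq := le_convergentDen hβ hirr (2 * m + 2)
  have hqm := convergentDen_pos hβ hirr (2 * m + 1)
  have hadd : convergentDen β (2 * m + 2) + convergentDen β (2 * m + 1)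
    ≤ convergentDen β (2 * m + 2 + 1) := convergentDen_add_le hβ hirr (2 * m + 1)
  have : NeZero (convergentDen β (2 * m + 2)) := ⟨by omega⟩
  obtain ⟨E', hE', htr⟩ := exists_trace_eq_two (q := convergentDen β (2 * m + 2))
    (fun k => (hopping_pos hβ hirr h₁ h₂ k).ne') (hopping_bounded β l₁ l₂)
    ⟨0, fun _ => by simp⟩ (fun k h1 h2 => by
      rw [hopping, hopping, sturmian_add_convergentDen_of_even hβ hirr ⟨m + 1, by ring⟩ h1
        (by omega) (by omega)]) (by omega) hψ hlt
  refine ⟨2 * m + 2, E', by omega, hE', ?_⟩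
  rw [traceSeq, transferMatrix, htr]
  norm_num

end

theorem spectrum_offDiagonalOperator {β : ℝ} (hβ : β ∈ Set.Icc (0 : ℝ) 1) (hirr : Irrational β)
    {lam₁ lam₂ : ℝ} (h₁ : 0 < lam₁) (h₂ : 0 < lam₂) :
    spectrum ℂ (offDiagonalOperator β lam₁ lam₂)
      = (fun E : ℝ => (E : ℂ)) '' pseudoSpectrum β lam₁ lam₂ := by
  ext z
  constructor
  · intro hz
    have hre : z = (z.re : ℂ) :=
      (isSelfAdjoint_jacobiOperator _ _ _ _).mem_spectrum_eq_re hz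
    refine ⟨z.re, ?_, hre.symm⟩
    rw [hre] at hz
    rcases traceSeq_dichotomy hβ hirr h₁ h₂ z.re with ⟨_, N, hN⟩ | h
    · obtain ⟨c, hc, hball⟩ := Metric.eventually_nhds_iff.mp hN
      obtain ⟨n, E', hn, hE', htr⟩ := exists_trace_le_two_near hβ hirr h₁ h₂ hz hc N
      exact absurd htr (hball (by rwa [Real.dist_eq]) n hn).not_ge
    · exact h.1
  · rintro ⟨E, hE, rfl⟩
    rcases traceSeq_dichotomy hβ hirr h₁ h₂ E with h | h
    · exact absurd hE h.1
    · exact mem_spectrum_of_frequently hβ hirr h₁ h₂ h.2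

end SturmianJacobi

end

theorem theorem1 (β : ℝ) (hβ : β ∈ Set.Icc (0 : ℝ) 1) (hirr : Irrational β)
    (lam₁ lam₂ : ℝ) (h₁ : 0 < lam₁) (h₂ : 0 < lam₂) :
    spectrum ℂ (SturmianJacobi.offDiagonalOperator β lam₁ lam₂)
      = (fun E : ℝ => (E : ℂ)) '' SturmianJacobi.pseudoSpectrum β lam₁ lam₂ :=
  SturmianJacobi.spectrum_offDiagonalOperator hβ hirr h₁ h₂
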